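/- Let $M$ be an $n$-dimensional real-analytic manifold, $G$ a compact connected Lie group, and $B\to M$ a smooth principal $G$-bundle with fibres $B_x$ ($x\in M$). *Graphs.* An edge is the image of an analytic embedding of $[0,1]$ into $M$; an oriented edge has an initial and a final vertex. A graph $\gamma$ is a finite set of edges such that distinct edges meet only at common end points and every edge is connected at each of its two ends with another edge of $\gamma$. Write $\gamma'\ge\gamma$ if every edge of $\gamma$ is a composition of edges of $\gamma'$ and every vertex of $\gamma$ is a vertex of $\gamma'$. *Connections on graphs.* For an edge $e$ let $\mathcal A_e$ be the set of parallel transports along $e$, i.e. of $G$-equivariant bijections from the fibre over the initial vertex to the fibre over the final vertex, reversal of the orientation of $e$ corresponding to inversion; let $\mathcal A_\gamma=\prod_{e\in\gamma}\mathcal A_e$. Points in the fibres over the vertices and an orientation of the edges give a bijection ("group valued chart") $\Lambda_\gamma:\mathcal A_\gamma\to G^{E}$, $E=\#\gamma$, through which $\mathcal A_\gamma$ is a manifold. For $\gamma'\ge\gamma$ let $p_{\gamma\gamma'}:\mathcal A_{\gamma'}\to\mathcal A_\gamma$ be given by composing parallel transports. The projective limit of this family is $\overline{\mathcal A}$. The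 group $\overline{\mathcal G}=\prod_{x\in M}\mathcal G_x$, $\mathcal G_x$ being the group of automorphisms of the fibre $B_x$, acts on each $\mathcal A_\gamma$ through its values at the vertices; the quotient is written $\mathcal A_\gamma/\mathcal G_\gamma$. *Co-metrics.* A co-metric tensor on $\overline{\mathcal A}$ is a family $(K_\gamma)_\gamma$ of real symmetric bilinear forms on the cotangent spaces of the $\mathcal A_\gamma$ which is consistent: $K_{\gamma'}(p^*_{\gamma\gamma'}\omega,p^*_{\gamma\gamma'}\nu)=K_\gamma(\omega,\nu)$ for all covectors $\omega,\nu$ at a point in the image of $p_{\gamma\gamma'}$, whenever $\gamma'\ge\gamma$. *The family $k_\gamma$.* Fix a bi-invariant contravariant metric $k$ on $G$, i.e. a scalar product on each cotangent space of $G$, invariant under left and right translations. At a vertex $v$ of $\gamma$ orient the edges at $v$ to be outgoing. For an edge $e$ at $v$ and a covector $\omega$ at $A\in\mathcal A_\gamma$, let $\omega_e$ be the covector on $G$ obtained by pulling $\omega$ back under the map $G\to\mathcal A_\gamma$ given by a group valued chart that varies only the $e$-component of $A$. Put $k_e(\omega,\nu)=k(\omega_e,\nu_e)$ and $k_{ee'}(\omega,\nu)=k(\omega_e,\nu_{e'})$,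 where covectors at different points of $G$ are compared by left translation, and $$k_v=\tfrac12\sum_e k_e+\tfrac12\sum_{(e,e')}k_{ee'},\qquad k_\gamma=\sum_v k_v ,$$ where $e$ runs over the edges at $v$, $(e,e')$ over the ordered pairs of edges at $v$ such that $e'\circ e^{-1}$ is a regular analytic curve near $v$, and $v$ over the vertices of $\gamma$. **Proposition.** The forms $k_\gamma$ do not depend on the choice of the points in the fibres, and: 1. $k_o=(k_\gamma)_\gamma$ is a co-metric tensor on $\overline{\mathcal A}$; 2. $k_o$ is natural: every (not necessarily vertical) automorphism of the bundle $B$ covering an analytic diffeomorphism $\Phi$ of $M$ carries $k_\gamma$ to $k_{\Phi(\gamma)}$ for every graph $\gamma$; 3. $k_o$ is $\overline{\mathcal G}$-invariant: the action of every element of $\overline{\mathcal G}$ on $\mathcal A_\gamma$ preserves $k_\gamma$; 4. $k_o$ defines a natural co-metric on $\overline{\mathcal A}/\overline{\mathcal G}$: for every analytic diffeomorphism $\Phi$ of $M$, each map $\Lambda_{\Phi(\gamma)}^{-1}\circ\Lambda_\gamma:\mathcal A_\gamma\to\mathcal A_{\Phi(\gamma)}$ (corresponding orientations, arbitrary points in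 the fibres) carries $k_\gamma$ to $k_{\Phi(\gamma)}$; for $\overline{\mathcal G}$-invariant one-forms $\omega,\nu$ on $\mathcal A_\gamma$ (the one-forms of the quotient) the function $k_\gamma(\omega,\nu)$ descends to $\mathcal A_\gamma/\mathcal G_\gamma$; pull-backs of invariant one-forms under $p_{\gamma\gamma'}$ and under these maps are again invariant, in the second case independent of the points chosen; and the resulting symmetric operation on invariant one-forms is consistent with the projections $\mathcal A_{\gamma'}/\mathcal G_{\gamma'}\to\mathcal A_\gamma/\mathcal G_\gamma$ and invariant under the induced action $\mathcal A_\gamma/\mathcal G_\gamma\to\mathcal A_{\Phi(\gamma)}/\mathcal G_{\Phi(\gamma)}$ of the analytic diffeomorphisms of $M$, which is independent of the points chosen. -/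

import Mathlib

open scoped Manifold ContDiff
open Set

set_option linter.unusedSectionVars false

noncomputable section

namespace FloatingLattice

/-! ### Analytic edges and graphs in an analytic manifold -/

section Graphs

variable (n : ℕ) {M : Type*} [TopologicalSpace M] [ChartedSpace (EuclideanSpace ℝ (Fin n)) M]

/-- `c` restricts to an analytic embedding of the closed interval `[0,1]` in `M`
(analytic up to and including the end points, immersive and injective).
The values of `c` outside a neighbourhood of `[0,1]` are irrelevant. -/
def IsParam (c : ℝ → M) : Prop :=
  (∀ t ∈ Icc (0 : ℝ) 1, ContMDiffAt 𝓘(ℝ, ℝ) (𝓡 n) ω c t) ∧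
  (∀ t ∈ Icc (0 : ℝ) 1, mfderiv 𝓘(ℝ, ℝ) (𝓡 n) c t ≠ 0) ∧
  InjOn c (Icc 0 1)

/-- `e` is an analytic edge running from `x` to `y`. Two embedded parametrizations with the same
image differ by an analytic diffeomorphism of `[0,1]`, so an unparametrized unoriented edge is the
same thing as its image `e`, and an orientation is the choice of the initial vertex `x` and of the
final vertex `y` among its two end points. -/
def IsArc (e : Set M) (x y : M) : Prop :=
  ∃ c : ℝ → M, IsParam n c ∧ c 0 = x ∧ c 1 = y ∧ c '' Icc 0 1 = e

/-- The end points of an edge. -/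
def ends (e : Set M) : Set M := {x | ∃ y, IsArc n e x y}

variable {n}

theorem IsParam.reverse {c : ℝ → M} (hc : IsParam n c) : IsParam n (fun t : ℝ => c (1 - t)) := by
  obtain ⟨h1, h2, h3⟩ := hc
  have hmem : ∀ t ∈ Icc (0 : ℝ) 1, 1 - t ∈ Icc (0 : ℝ) 1 := by
    intro t ht
    exact ⟨by linarith [ht.2], by linarith [ht.1]⟩
  have hr : ∀ t : ℝ, ContMDiffAt 𝓘(ℝ, ℝ) 𝓘(ℝ, ℝ) ω (fun t : ℝ => 1 - t) t := by
    intro t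
    exact (contDiff_const.sub contDiff_id).contMDiff.contMDiffAt
  refine ⟨fun t ht => (h1 (1 - t) (hmem t ht)).comp t (hr t), fun t ht h0 => ?_, ?_⟩
  · apply h2 (1 - t) (hmem t ht)
    have hd : MDifferentiableAt 𝓘(ℝ, ℝ) (𝓡 n) c (1 - t) :=
      (h1 (1 - t) (hmem t ht)).mdifferentiableAt (by simp)
    have hr' : MDifferentiableAt 𝓘(ℝ, ℝ) 𝓘(ℝ, ℝ) (fun t : ℝ => 1 - t) t :=
      (hr t).mdifferentiableAt (by simp)
    have hcomp := mfderiv_comp t hd hr'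
    have h0' : mfderiv 𝓘(ℝ, ℝ) (𝓡 n) (c ∘ fun t : ℝ => 1 - t) t = 0 := h0
    rw [h0'] at hcomp
    have hder : mfderiv 𝓘(ℝ, ℝ) 𝓘(ℝ, ℝ) (fun t : ℝ => 1 - t) t
        = -ContinuousLinearMap.id ℝ ℝ := by
      rw [mfderiv_eq_fderiv]
      have : HasFDerivAt (fun t : ℝ => 1 - t) (-ContinuousLinearMap.id ℝ ℝ) t := by
        simpa using (hasFDerivAt_id t).const_sub (1 : ℝ)
      exact this.fderiv
    rw [hder] at hcomp
    refine ContinuousLinearMap.ext fun v => ?_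
    have hv := DFunLike.congr_fun hcomp (-v : ℝ)
    have hv' : (0 : EuclideanSpace ℝ (Fin n)) =
        mfderiv 𝓘(ℝ, ℝ) (𝓡 n) c (1 - t) (-(-v : ℝ)) := hv
    rw [neg_neg] at hv'
    exact hv'.symm
  · intro s hs t ht hst
    have := h3 (hmem s hs) (hmem t ht) hst
    linarith

theorem IsArc.symm {e : Set M} {x y : M} (h : IsArc n e x y) : IsArc n e y x := by
  obtain ⟨c, hc, h0, h1, he⟩ := h
  refine ⟨fun t => c (1 - t), hc.reverse, by simpa using h1, by simpa using h0, ?_⟩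
  rw [← he]
  ext p
  constructor
  · rintro ⟨t, ht, rfl⟩
    exact ⟨1 - t, ⟨by linarith [ht.2], by linarith [ht.1]⟩, rfl⟩
  · rintro ⟨t, ht, rfl⟩
    exact ⟨1 - t, ⟨by linarith [ht.2], by linarith [ht.1]⟩, by simp⟩

theorem IsArc.ne {e : Set M} {x y : M} (h : IsArc n e x y) : x ≠ y := by
  obtain ⟨c, hc, rfl, rfl, -⟩ := h
  intro h
  have := hc.2.2 (by simp) (by simp) h
  norm_num at this

theorem IsArc.mem_ends_left {e : Set M} {x y : M} (h : IsArc n e x y) : x ∈ ends n e := ⟨y, h⟩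

theorem IsArc.mem_ends_right {e : Set M} {x y : M} (h : IsArc n e x y) : y ∈ ends n e :=
  ⟨x, h.symm⟩

/-- The end points of an edge are determined by the edge. -/
theorem IsArc.eq_or_eq [T2Space M] {e : Set M} {x y v : M} (h : IsArc n e x y)
    (hv : v ∈ ends n e) : v = x ∨ v = y := by
  obtain ⟨c, ⟨hc, -, hinj⟩, rfl, rfl, he⟩ := h
  obtain ⟨w, d, ⟨hd, -, dinj⟩, rfl, rfl, he'⟩ := hv
  have hcont : ContinuousOn c (Icc 0 1) := fun t ht => (hc t ht).continuousAt.continuousWithinAt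
  have dcont : ContinuousOn d (Icc 0 1) := fun t ht => (hd t ht).continuousAt.continuousWithinAt
  have hd0 : d 0 ∈ c '' Icc (0 : ℝ) 1 := by
    rw [he, ← he']; exact ⟨0, by simp, rfl⟩
  obtain ⟨s, hs, hs0⟩ := hd0
  by_contra hne
  push Not at hne
  have hs1 : 0 < s := lt_of_le_of_ne hs.1 (fun h => hne.1 (by rw [← hs0, ← h]))
  have hs2 : s < 1 := lt_of_le_of_ne hs.2 (fun h => hne.2 (by rw [← hs0, h]))
  have hconn : IsPreconnected (d '' Ioc 0 1) :=
    isPreconnected_Ioc.image d (dcont.mono Ioc_subset_Icc_self)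
  have heq : d '' Ioc 0 1 = e \ {d 0} := by
    rw [← he']
    ext p
    constructor
    · rintro ⟨t, ht, rfl⟩
      refine ⟨⟨t, Ioc_subset_Icc_self ht, rfl⟩, fun h => ?_⟩
      have := dinj (Ioc_subset_Icc_self ht) (by simp) h
      exact absurd this ht.1.ne'
    · rintro ⟨⟨t, ht, rfl⟩, hne⟩
      refine ⟨t, ⟨lt_of_le_of_ne ht.1 (fun h => hne (by simp [← h])), ht.2⟩, rfl⟩
  rw [heq] at hconn
  have hK1 : IsClosed (c '' Icc 0 s) :=
    (isCompact_Icc.image_of_continuousOn (hcont.mono (Icc_subset_Icc_right hs.2))).isClosed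
  have hK2 : IsClosed (c '' Icc s 1) :=
    (isCompact_Icc.image_of_continuousOn (hcont.mono (Icc_subset_Icc_left hs.1))).isClosed
  have hmem0 : (0 : ℝ) ∈ Icc (0 : ℝ) 1 := by simp
  have hmem1 : (1 : ℝ) ∈ Icc (0 : ℝ) 1 := by simp
  obtain ⟨p, ⟨hpe, hps⟩, ⟨a, ha, hap⟩, ⟨b, hb, hbp⟩⟩ :=
    isPreconnected_closed_iff.1 hconn _ _ hK1 hK2
      (by
        rintro p ⟨hp, -⟩
        rw [← he] at hp
        obtain ⟨t, ht, rfl⟩ := hp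
        rcases le_total t s with h | h
        · exact Or.inl ⟨t, ⟨ht.1, h⟩, rfl⟩
        · exact Or.inr ⟨t, ⟨h, ht.2⟩, rfl⟩)
      ⟨c 0, ⟨by rw [← he]; exact ⟨0, hmem0, rfl⟩, fun h => hne.1 (by simpa using h.symm)⟩,
        ⟨0, ⟨le_rfl, hs.1⟩, rfl⟩⟩
      ⟨c 1, ⟨by rw [← he]; exact ⟨1, hmem1, rfl⟩, fun h => hne.2 (by simpa using h.symm)⟩,
        ⟨1, ⟨hs.2, le_rfl⟩, rfl⟩⟩
  have hab : a = b := hinj ⟨ha.1, ha.2.trans hs.2⟩ ⟨hs.1.trans hb.1, hb.2⟩ (hap.trans hbp.symm)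
  have has : a = s := le_antisymm ha.2 (hab ▸ hb.1)
  exact hps (by rw [← hap, has, hs0]; rfl)

theorem finite_ends [T2Space M] (e : Set M) : (ends n e).Finite := by
  rcases (ends n e).eq_empty_or_nonempty with h | ⟨x, y, h⟩
  · rw [h]; exact Set.finite_empty
  · exact (Set.toFinite {x, y}).subset fun v hv => h.eq_or_eq hv

variable (n M)

/-- A (closed, unoriented) graph: a finite set of embedded analytic edges which meet only at
common end points and such that each edge is connected at both ends with another edge. -/
structure Graph where
  edges : Finset (Set M)
  isEdge : ∀ e ∈ edges, ∃ x y, IsArc n e x y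
  inter : ∀ e ∈ edges, ∀ e' ∈ edges, e ≠ e' → e ∩ e' ⊆ ends n e ∩ ends n e'
  closed : ∀ e ∈ edges, ∀ v ∈ ends n e, ∃ e' ∈ edges, e' ≠ e ∧ v ∈ ends n e'

variable {n M}

/-- The vertices of a graph. -/
def Graph.vertices [T2Space M] (γ : Graph n M) : Finset M :=
  (γ.edges.finite_toSet.biUnion fun e _ => finite_ends (n := n) e).toFinset

/-- The edges of `γ` at the point `v`. -/
def Graph.star (γ : Graph n M) (v : M) : Type _ := {e : γ.edges // v ∈ ends n e.1}

instance (γ : Graph n M) (v : M) : Fintype (γ.star v) :=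
  letI := Classical.decPred fun e : γ.edges => v ∈ ends n e.1
  inferInstanceAs (Fintype {e : γ.edges // v ∈ ends n e.1})

/-- The vertex of `e` other than `v`. -/
def Graph.star.target {γ : Graph n M} {v : M} (e : γ.star v) : M := e.2.choose

theorem Graph.star.isArc {γ : Graph n M} {v : M} (e : γ.star v) : IsArc n e.1.1 v e.target :=
  e.2.choose_spec

variable (n) in
/-- The edges `e` and `e'` with the common end point `v` form an analytic arc at `v`: running
through the end of `e` towards `v` and continuing from `v` along `e'` is a regular analytic
curve near `v`. -/
def FormAnalyticArc (v : M) (e e' : Set M) : Prop :=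
  ∃ c : ℝ → M, c 0 = v ∧ ContMDiffAt 𝓘(ℝ, ℝ) (𝓡 n) ω c 0 ∧
    mfderiv 𝓘(ℝ, ℝ) (𝓡 n) c 0 ≠ 0 ∧
    ∃ ε > 0, (∀ t ∈ Ioc (-ε) 0, c t ∈ e) ∧ (∀ t ∈ Ico 0 ε, c t ∈ e')

/-- Composable non-empty strings of oriented edges of `γ`, from one vertex to another. -/
inductive GraphPath (γ : Graph n M) : M → M → Type _
  | single {x y : M} (e : γ.edges) (h : IsArc n e.1 x y) : GraphPath γ x y
  | cons {x y z : M} (e : γ.edges) (h : IsArc n e.1 x y) (p : GraphPath γ y z) : GraphPath γ x z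

/-- The curve `c`, restricted to `[a,b]`, runs successively through the edges of the string. -/
def GraphPath.IsTraversedBy {γ : Graph n M} (c : ℝ → M) :
    {x y : M} → GraphPath γ x y → ℝ → ℝ → Prop
  | x, y, .single e _, a, b => a < b ∧ c a = x ∧ c b = y ∧ c '' Icc a b = e.1
  | x, _, .cons (y := y) e _ p, a, b =>
      ∃ t, a < t ∧ t < b ∧ c a = x ∧ c t = y ∧ c '' Icc a t = e.1 ∧ p.IsTraversedBy c t b

/-- The edge `e`, oriented from `x` to `y`, is the composition of the string `p`. -/
def GraphPath.Composes {γ : Graph n M} {x y : M} (p : GraphPath γ x y) (e : Set M) : Prop :=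
  ∃ c : ℝ → M, IsParam n c ∧ c '' Icc 0 1 = e ∧ p.IsTraversedBy c 0 1

/-- `γ.le γ'` : each edge of `γ` is a composition of edges of `γ'` and each vertex of `γ` is a
vertex of `γ'`. -/
def Graph.le [T2Space M] (γ γ' : Graph n M) : Prop :=
  (∀ e ∈ γ.edges, ∀ x y, IsArc n e x y → ∃ p : GraphPath γ' x y, p.Composes e) ∧
  γ.vertices ⊆ γ'.vertices

instance [T2Space M] : LE (Graph n M) := ⟨Graph.le⟩

variable (n M) in
/-- Analytic diffeomorphisms of `M`. -/
abbrev AnalyticDiffeo := Diffeomorph (𝓡 n) (𝓡 n) M M ω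

theorem IsParam.map {c : ℝ → M} (hc : IsParam n c) (Φ : AnalyticDiffeo n M) :
    IsParam n (fun t => Φ (c t)) := by
  obtain ⟨h1, h2, h3⟩ := hc
  refine ⟨fun t ht => (Φ.contMDiff (c t)).comp t (h1 t ht), fun t ht h0 => ?_,
    fun s hs t ht h => h3 hs ht (Φ.injective h)⟩
  apply h2 t ht
  have hd : MDifferentiableAt 𝓘(ℝ, ℝ) (𝓡 n) (fun t => Φ (c t)) t :=
    ((Φ.contMDiff (c t)).comp t (h1 t ht)).mdifferentiableAt (by simp)
  have hs : MDifferentiableAt (𝓡 n) (𝓡 n) Φ.symm (Φ (c t)) :=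
    (Φ.symm.contMDiff (Φ (c t))).mdifferentiableAt (by simp)
  have hcomp := mfderiv_comp t hs hd
  have hfun : (Φ.symm ∘ fun t => Φ (c t)) = c := by
    funext s; simp
  rw [h0, hfun] at hcomp
  rw [hcomp]
  exact ContinuousLinearMap.comp_zero _

theorem IsArc.map {e : Set M} {x y : M} (h : IsArc n e x y) (Φ : AnalyticDiffeo n M) :
    IsArc n (Φ '' e) (Φ x) (Φ y) := by
  obtain ⟨c, hc, rfl, rfl, rfl⟩ := h
  exact ⟨fun t => Φ (c t), hc.map Φ, rfl, rfl, by rw [image_image]⟩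

theorem IsArc.comap {e : Set M} {x y : M} (Φ : AnalyticDiffeo n M) (h : IsArc n e x y) :
    IsArc n (Φ ⁻¹' e) (Φ.symm x) (Φ.symm y) := by
  have h' := h.map Φ.symm
  have : Φ.symm '' e = Φ ⁻¹' e := Φ.toEquiv.symm.image_eq_preimage_symm e
  rwa [this] at h'

theorem preimage_image_diffeo (Φ : AnalyticDiffeo n M) (e : Set M) : Φ ⁻¹' (Φ '' e) = e :=
  preimage_image_eq e Φ.injective

theorem mem_ends_image {e : Set M} (Φ : AnalyticDiffeo n M) {v : M} :
    v ∈ ends n (Φ '' e) ↔ Φ.symm v ∈ ends n e := by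
  constructor
  · rintro ⟨w, h⟩
    have := h.comap Φ
    rw [preimage_image_diffeo] at this
    exact ⟨_, this⟩
  · rintro ⟨w, h⟩
    have := h.map Φ
    rw [Φ.apply_symm_apply] at this
    exact ⟨_, this⟩

open Classical in
/-- The image of a graph under an analytic diffeomorphism. -/
def Graph.map (Φ : AnalyticDiffeo n M) (γ : Graph n M) : Graph n M where
  edges := γ.edges.image fun e => Φ '' e
  isEdge := by
    intro e he
    obtain ⟨e, he₀, rfl⟩ := Finset.mem_image.1 he
    obtain ⟨x, y, h⟩ := γ.isEdge e he₀
    exact ⟨_, _, h.map Φ⟩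
  inter := by
    intro e he e' he' hne v hv
    obtain ⟨e, he₀, rfl⟩ := Finset.mem_image.1 he
    obtain ⟨e', he₀', rfl⟩ := Finset.mem_image.1 he'
    have hv' : Φ.symm v ∈ e ∩ e' := by
      obtain ⟨⟨a, ha, rfl⟩, ⟨b, hb, hab⟩⟩ := hv
      rw [Φ.injective hab] at hb
      simpa using ⟨ha, hb⟩
    have := γ.inter e he₀ e' he₀' (fun h => hne (by rw [h])) hv'
    exact ⟨(mem_ends_image Φ).2 this.1, (mem_ends_image Φ).2 this.2⟩
  closed := by
    intro e he v hv
    obtain ⟨e, he₀, rfl⟩ := Finset.mem_image.1 he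
    obtain ⟨e', he', hne, h⟩ := γ.closed e he₀ _ ((mem_ends_image Φ).1 hv)
    refine ⟨Φ '' e', Finset.mem_image_of_mem _ he', fun h => hne ?_, (mem_ends_image Φ).2 h⟩
    exact Φ.injective.image_injective h

theorem Graph.preimage_mem {Φ : AnalyticDiffeo n M} {γ : Graph n M} {e : Set M}
    (he : e ∈ (γ.map Φ).edges) : Φ ⁻¹' e ∈ γ.edges := by
  classical
  obtain ⟨e, he₀, rfl⟩ := Finset.mem_image.1 he
  rwa [preimage_image_diffeo]

end Graphs

/-! ### Principal bundles, automorphisms, generalized gauge transformations -/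

section Bundle

variable (n : ℕ) (M : Type*) [TopologicalSpace M] [ChartedSpace (EuclideanSpace ℝ (Fin n)) M]
  (EG : Type*) [NormedAddCommGroup EG] [NormedSpace ℝ EG]
  (G : Type*) [TopologicalSpace G] [ChartedSpace EG G] [Group G]
  (EP : Type*) [NormedAddCommGroup EP] [NormedSpace ℝ EP]
  (P : Type*) [TopologicalSpace P] [ChartedSpace EP P]

/-- A smooth principal fibre bundle over `M` with structure group `G` and total space `P`
(on which `G` acts from the right). -/
structure PrincipalBundle where
  proj : P → M
  act : P → G → P
  act_one : ∀ p, act p 1 = p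
  act_mul : ∀ p g h, act p (g * h) = act (act p g) h
  proj_act : ∀ p g, proj (act p g) = proj p
  smooth_proj : ContMDiff 𝓘(ℝ, EP) (𝓡 n) ∞ proj
  smooth_act : ContMDiff (𝓘(ℝ, EP).prod 𝓘(ℝ, EG)) 𝓘(ℝ, EP) ∞ fun q : P × G => act q.1 q.2
  locally_trivial : ∀ x : M, ∃ t : Bundle.Trivialization G proj, x ∈ t.baseSet ∧
    (∀ p ∈ t.source, ∀ g, t (act p g) = ((t p).1, (t p).2 * g)) ∧
    ContMDiffOn 𝓘(ℝ, EP) ((𝓡 n).prod 𝓘(ℝ, EG)) ∞ t t.source ∧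
    ContMDiffOn ((𝓡 n).prod 𝓘(ℝ, EG)) 𝓘(ℝ, EP) ∞ t.toOpenPartialHomeomorph.symm t.target

variable {n M EG G EP P}

namespace PrincipalBundle

variable (B : PrincipalBundle n M EG G EP P)

/-- The fibre over `x`. -/
def Fiber (x : M) : Type _ := {p : P // B.proj p = x}

variable {B}

/-- The action of the structure group on a fibre. -/
def Fiber.act {x : M} (p : B.Fiber x) (g : G) : B.Fiber x :=
  ⟨B.act p.1 g, (B.proj_act p.1 g).trans p.2⟩

theorem Fiber.act_one {x : M} (p : B.Fiber x) : p.act 1 = p := Subtype.ext (B.act_one p.1)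

theorem Fiber.act_mul {x : M} (p : B.Fiber x) (g h : G) : p.act (g * h) = (p.act g).act h :=
  Subtype.ext (B.act_mul p.1 g h)

theorem Fiber.existsUnique_act {x : M} (p q : B.Fiber x) : ∃! g : G, p.act g = q := by
  obtain ⟨p, hp⟩ := p
  obtain ⟨q, hq⟩ := q
  obtain ⟨t, hx, heq, -, -⟩ := B.locally_trivial x
  have hps : p ∈ t.source := by rw [t.mem_source, hp]; exact hx
  have hqs : q ∈ t.source := by rw [t.mem_source, hq]; exact hx
  have hgs : ∀ g, B.act p g ∈ t.source := fun g => by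
    rw [t.mem_source, B.proj_act, hp]; exact hx
  have key : ∀ g, B.act p g = q ↔ (t p).2 * g = (t q).2 := by
    intro g
    constructor
    · rintro rfl
      rw [heq p hps g]
    · intro h
      apply t.injOn (hgs g) hqs
      change t (B.act p g) = t q
      rw [heq p hps g]
      refine Prod.ext ?_ h
      change (t p).1 = (t q).1
      rw [t.coe_fst hps, t.coe_fst hqs, hp, hq]
  refine ⟨(t p).2⁻¹ * (t q).2, Subtype.ext ((key _).2 (by simp)), fun g hg => ?_⟩
  have := (key g).1 (congrArg Subtype.val hg)
  rw [← this]; simp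

/-- The element of the structure group which carries `p` to `q`. -/
def Fiber.div {x : M} (p q : B.Fiber x) : G := (p.existsUnique_act q).choose

theorem Fiber.act_div {x : M} (p q : B.Fiber x) : p.act (p.div q) = q :=
  (p.existsUnique_act q).choose_spec.1

theorem Fiber.div_act {x : M} (p : B.Fiber x) (g : G) : p.div (p.act g) = g :=
  ((p.existsUnique_act (p.act g)).choose_spec.2 g rfl).symm

theorem Fiber.nonempty (x : M) : Nonempty (B.Fiber x) := by
  obtain ⟨t, hx, -⟩ := B.locally_trivial x
  exact ⟨⟨t.toOpenPartialHomeomorph.symm (x, 1), t.proj_symm_apply' hx⟩⟩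

variable (B)

/-- Isomorphisms between two fibres (`G`-equivariant bijections). -/
def FiberIso (x y : M) : Type _ :=
  {φ : B.Fiber x ≃ B.Fiber y // ∀ p g, φ (p.act g) = (φ p).act g}

/-- A choice of a point in each fibre. -/
def Points : Type _ := ∀ x : M, B.Fiber x

variable {B}

namespace FiberIso

variable {x y z : M}

theorem ext_of {φ ψ : B.FiberIso x y} (h : ∀ p, φ.1 p = ψ.1 p) : φ = ψ :=
  Subtype.ext (Equiv.ext h)

/-- The inverse isomorphism. -/
def symm (φ : B.FiberIso x y) : B.FiberIso y x :=
  ⟨φ.1.symm, fun p g => by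
    rw [Equiv.symm_apply_eq, φ.2, Equiv.apply_symm_apply]⟩

/-- First `φ`, then `ψ`. -/
def trans (φ : B.FiberIso x y) (ψ : B.FiberIso y z) : B.FiberIso x z :=
  ⟨φ.1.trans ψ.1, fun p g => by simp only [Equiv.trans_apply, φ.2, ψ.2]⟩

/-- The unique isomorphism of fibres which carries `p` to `q`. -/
def ofPoints (p : B.Fiber x) (q : B.Fiber y) : B.FiberIso x y :=
  ⟨{  toFun := fun r => q.act (p.div r)
      invFun := fun r => p.act (q.div r)
      left_inv := fun r => by
        change p.act (q.div (q.act (p.div r))) = r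
        rw [Fiber.div_act, Fiber.act_div]
      right_inv := fun r => by
        change q.act (p.div (p.act (q.div r))) = r
        rw [Fiber.div_act, Fiber.act_div] }, fun r g => by
    change q.act (p.div (r.act g)) = (q.act (p.div r)).act g
    rw [← Fiber.act_mul]
    congr 1
    conv_lhs => rw [← Fiber.act_div p r]
    rw [← Fiber.act_mul, Fiber.div_act]⟩

/-- Given points `p`, `q` in the fibres over `x` and `y`, an isomorphism `φ` of these fibres is
described by the group element `g` with `φ p = q g`. -/
def coord (p : B.Fiber x) (q : B.Fiber y) : B.FiberIso x y ≃ G where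
  toFun φ := q.div (φ.1 p)
  invFun g := ofPoints p (q.act g)
  left_inv φ := by
    apply ext_of
    intro r
    change (q.act (q.div (φ.1 p))).act (p.div r) = φ.1 r
    rw [Fiber.act_div, ← φ.2, Fiber.act_div]
  right_inv g := by
    change q.div ((q.act g).act (p.div p)) = g
    have : p.div p = 1 := by
      have := p.div_act (1 : G)
      rwa [Fiber.act_one] at this
    rw [this, Fiber.act_one, Fiber.div_act]

theorem symm_symm (φ : B.FiberIso x y) : φ.symm.symm = φ := rfl

end FiberIso

variable (B)

/-- A parallel transport along an (unoriented) edge `e`: an isomorphism from the fibre over the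
initial vertex to the fibre over the final vertex for each of the two orientations, such that
reversing the orientation gives the inverse. -/
@[ext]
structure EdgeTransport (e : Set M) where
  map : ∀ x y : M, IsArc n e x y → B.FiberIso x y
  map_symm : ∀ (x y : M) (h : IsArc n e x y), map y x h.symm = (map x y h).symm

variable {B}

/-- For a fixed orientation of the edge, a parallel transport is an arbitrary isomorphism of the
fibre over the initial vertex with the fibre over the final vertex. -/
def EdgeTransport.equivIso [T2Space M] {e : Set M} {x y : M} (h : IsArc n e x y) :
    B.EdgeTransport e ≃ B.FiberIso x y where
  toFun T := T.map x y h
  invFun φ :=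
    { map := fun x' y' h' => by
        classical
        exact if hx : x' = x then
          have hy : y' = y := by
            subst hx
            exact (h.eq_or_eq h'.mem_ends_right).resolve_left h'.ne.symm
          hx ▸ hy ▸ φ
        else
          have hx' : x' = y := (h.eq_or_eq h'.mem_ends_left).resolve_left hx
          have hy' : y' = x := by
            subst hx'
            exact (h.eq_or_eq h'.mem_ends_right).resolve_right h'.ne.symm
          hx' ▸ hy' ▸ φ.symm
      map_symm := by
        intro x' y' h'
        by_cases hx : x' = x
        · have hy : y' = y := by
            subst hx
            exact (h.eq_or_eq h'.mem_ends_right).resolve_left h'.ne.symm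
          subst hx hy
          simp [h.ne.symm]
        · have hx' : x' = y := (h.eq_or_eq h'.mem_ends_left).resolve_left hx
          have hy' : y' = x := by
            subst hx'
            exact (h.eq_or_eq h'.mem_ends_right).resolve_right h'.ne.symm
          subst hx' hy'
          simp [h.ne.symm, FiberIso.symm_symm] }
  left_inv T := by
    ext x' y' h'
    by_cases hx : x' = x
    · have hy : y' = y := by
        subst hx
        exact (h.eq_or_eq h'.mem_ends_right).resolve_left h'.ne.symm
      subst hx hy
      simp
    · have hx' : x' = y := (h.eq_or_eq h'.mem_ends_left).resolve_left hx
      have hy' : y' = x := by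
        subst hx'
        exact (h.eq_or_eq h'.mem_ends_right).resolve_right h'.ne.symm
      subst hx' hy'
      simp [h.ne.symm, T.map_symm _ _ h]
  right_inv φ := by simp

/-- The group valued chart of the space of parallel transports along an edge which is oriented
from `x` to `y`. -/
def EdgeTransport.chart [T2Space M] (b : B.Points) {e : Set M} {x y : M} (h : IsArc n e x y) :
    B.EdgeTransport e ≃ G :=
  (EdgeTransport.equivIso h).trans (FiberIso.coord (b x) (b y))

variable (B) [T2Space M]

/-! ### The spaces of connections on graphs -/

/-- The space `𝒜_γ = ∏_e 𝒜_e` of connections on the graph `γ`: a parallel transport along each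
edge of `γ`. -/
def Conn (γ : Graph n M) : Type _ := ∀ e : γ.edges, B.EdgeTransport e.1

variable {B}

end PrincipalBundle

/-- An orientation of all the edges of a graph. -/
structure Graph.Orientation (γ : Graph n M) where
  src : γ.edges → M
  tgt : γ.edges → M
  isArc : ∀ e : γ.edges, IsArc n e.1 (src e) (tgt e)

theorem Graph.nonempty_orientation (γ : Graph n M) : Nonempty γ.Orientation :=
  ⟨{  src := fun e => (γ.isEdge e.1 e.2).choose
      tgt := fun e => (γ.isEdge e.1 e.2).choose_spec.choose
      isArc := fun e => (γ.isEdge e.1 e.2).choose_spec.choose_spec }⟩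

namespace PrincipalBundle

variable {B : PrincipalBundle n M EG G EP P} [T2Space M]

theorem nonempty_points (B : PrincipalBundle n M EG G EP P) : Nonempty B.Points :=
  ⟨fun x => (Fiber.nonempty x).some⟩

/-- Some orientation of a graph. -/
def _root_.FloatingLattice.Graph.someOrientation (γ : Graph n M) : γ.Orientation :=
  γ.nonempty_orientation.some

/-- The group valued chart `Λ_γ : 𝒜_γ → G^E` given by a point in each fibre and an orientation
of the edges. -/
def Conn.chart {γ : Graph n M} (b : B.Points) (o : γ.Orientation) : B.Conn γ ≃ (γ.edges → G) :=
  Equiv.piCongrRight fun e => EdgeTransport.chart b (o.isArc e)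

/-- Some group valued chart. It is used to define the manifold structure of `𝒜_γ`, which does not
depend on it. -/
def Conn.someChart (B : PrincipalBundle n M EG G EP P) (γ : Graph n M) :
    B.Conn γ ≃ (γ.edges → G) :=
  Conn.chart B.nonempty_points.some γ.someOrientation

instance (γ : Graph n M) : TopologicalSpace (B.Conn γ) :=
  TopologicalSpace.induced (Conn.someChart B γ) inferInstance

/-- The chart as a homeomorphism. -/
def Conn.homeo (B : PrincipalBundle n M EG G EP P) (γ : Graph n M) :
    B.Conn γ ≃ₜ (γ.edges → G) :=
  (Conn.someChart B γ).toHomeomorphOfIsInducing ⟨rfl⟩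

/-- The manifold structure of `𝒜_γ`, transported from `G^E` by a group valued chart. -/
instance (γ : Graph n M) : ChartedSpace (ModelPi fun _ : γ.edges => EG) (B.Conn γ) :=
  letI : ChartedSpace (γ.edges → G) (B.Conn γ) :=
    (Conn.homeo B γ).toOpenPartialHomeomorph.singletonChartedSpace rfl
  ChartedSpace.comp _ (γ.edges → G) _

variable (EG) in
/-- The model of the manifolds `𝒜_γ`. -/
abbrev model (γ : Graph n M) :
    ModelWithCorners ℝ (∀ _ : γ.edges, EG) (ModelPi fun _ : γ.edges => EG) :=
  ModelWithCorners.pi fun _ : γ.edges => 𝓘(ℝ, EG)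

/-- The cotangent space of `𝒜_γ` at `A`. -/
abbrev Covector {γ : Graph n M} (A : B.Conn γ) : Type _ :=
  TangentSpace (model EG γ) A →L[ℝ] ℝ

/-- Pull-back of a covector under a map between spaces of connections. -/
def pullCov {γ γ' : Graph n M} (f : B.Conn γ' → B.Conn γ) (A : B.Conn γ')
    (α : Covector (f A)) : Covector A :=
  α.comp (mfderiv (model EG γ') (model EG γ) f A)

/-! ### Projections, gauge transformations, automorphisms, diffeomorphisms -/

/-- The product of the parallel transports along a string of edges. -/
def Conn.alongPath {γ : Graph n M} (A : B.Conn γ) :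
    {x y : M} → GraphPath γ x y → B.FiberIso x y
  | _, _, .single e h => (A e).map _ _ h
  | _, _, .cons e h p => ((A e).map _ _ h).trans (A.alongPath p)

/-- The projection `p_{γγ'} : 𝒜_{γ'} → 𝒜_γ` for `γ ≤ γ'`: the parallel transport along an edge
`e` of `γ` is the product of the parallel transports along the edges of `γ'` of which `e` is
composed. (The decomposition of an oriented edge is unique.) -/
def Conn.proj {γ γ' : Graph n M} (h : γ ≤ γ') (A : B.Conn γ') : B.Conn γ := fun e =>
  (EdgeTransport.equivIso (γ.someOrientation.isArc e)).symm
    (A.alongPath (h.1 e.1 e.2 _ _ (γ.someOrientation.isArc e)).choose)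

variable (B) in
/-- The group of generalized gauge transformations: a (not necessarily continuous) family of
automorphisms of the fibres. -/
def GaugeGroup : Type _ := ∀ x : M, B.FiberIso x x

/-- The action of a gauge transformation on parallel transports along an edge. -/
def EdgeTransport.gauge (g : B.GaugeGroup) {e : Set M} (T : B.EdgeTransport e) :
    B.EdgeTransport e where
  map x y h := ((g x).symm.trans (T.map x y h)).trans (g y)
  map_symm x y h := by rw [T.map_symm x y h]; rfl

/-- The action of a gauge transformation on `𝒜_γ` (through its values at the vertices). -/
def Conn.gauge (g : B.GaugeGroup) {γ : Graph n M} (A : B.Conn γ) : B.Conn γ :=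
  fun e => (A e).gauge g

/-- An analytic diffeomorphism `Φ` and isomorphisms from the fibre over `Φ⁻¹ y` to the fibre over
`y`, for all `y`, carry connections on `γ` to connections on `Φ(γ)`. -/
def Conn.transfer (Φ : AnalyticDiffeo n M) (τ : ∀ y : M, B.FiberIso (Φ.symm y) y)
    {γ : Graph n M} (A : B.Conn γ) : B.Conn (γ.map Φ) := fun e =>
  { map := fun x y h =>
      ((τ x).symm.trans
        ((A ⟨Φ ⁻¹' e.1, Graph.preimage_mem e.2⟩).map _ _ (h.comap Φ))).trans (τ y)
    map_symm := fun x y h => by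
      rw [(A ⟨Φ ⁻¹' e.1, Graph.preimage_mem e.2⟩).map_symm _ _ (h.comap Φ)]; rfl }

variable (B) in
/-- Automorphisms of the principal bundle (not necessarily vertical): equivariant diffeomorphisms
of the total space which cover an analytic diffeomorphism of the base. -/
structure Automorphism where
  total : Diffeomorph 𝓘(ℝ, EP) 𝓘(ℝ, EP) P P ∞
  base : AnalyticDiffeo n M
  proj_total : ∀ p, B.proj (total p) = base (B.proj p)
  total_act : ∀ p g, total (B.act p g) = B.act (total p) g

/-- The restriction of an automorphism to a fibre. -/
def Automorphism.fiberIso (F : B.Automorphism) (y : M) : B.FiberIso (F.base.symm y) y :=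
  ⟨{  toFun := fun p => ⟨F.total p.1, by rw [F.proj_total, p.2, F.base.apply_symm_apply]⟩
      invFun := fun q => ⟨F.total.symm q.1, by
        apply F.base.injective
        have h := F.proj_total (F.total.symm q.1)
        rw [F.total.apply_symm_apply] at h
        exact h.symm.trans (q.2.trans (F.base.apply_symm_apply y).symm)⟩
      left_inv := fun p => Subtype.ext (F.total.symm_apply_apply p.1)
      right_inv := fun q => Subtype.ext (F.total.apply_symm_apply q.1) },
    fun p g => Subtype.ext (F.total_act p.1 g)⟩

/-- The action of an automorphism on connections on graphs. -/
def Conn.automorphism (F : B.Automorphism) {γ : Graph n M} (A : B.Conn γ) :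
    B.Conn (γ.map F.base) :=
  A.transfer F.base F.fiberIso

/-- The map `Λ_{Φ(γ)}⁻¹ ∘ Λ_γ : 𝒜_γ → 𝒜_{Φ(γ)}`, where the group valued chart `Λ_γ` is given by
`b` and an orientation of `γ`, and `Λ_{Φ(γ)}` by `b'` and the corresponding orientation of
`Φ(γ)`. -/
def Conn.diffeo (Φ : AnalyticDiffeo n M) (b b' : B.Points) {γ : Graph n M} (A : B.Conn γ) :
    B.Conn (γ.map Φ) :=
  A.transfer Φ fun y => FiberIso.ofPoints (b (Φ.symm y)) (b' y)

/-! ### The quotients by the gauge transformations -/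

variable (B) in
/-- The quotient `𝒜_γ / 𝒢_γ`. -/
def QConn (γ : Graph n M) : Type _ :=
  Quot fun A A' : B.Conn γ => ∃ g : B.GaugeGroup, A' = A.gauge g

/-- The class of a connection in `𝒜_γ / 𝒢_γ`. -/
def Conn.toQ {γ : Graph n M} (A : B.Conn γ) : B.QConn γ := Quot.mk _ A

theorem Conn.alongPath_gauge (g : B.GaugeGroup) {γ : Graph n M} (A : B.Conn γ) {x y : M}
    (p : GraphPath γ x y) :
    (A.gauge g).alongPath p = ((g x).symm.trans (A.alongPath p)).trans (g y) := by
  induction p with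
  | single e h => rfl
  | cons e h p ih =>
    simp only [Conn.alongPath]
    rw [ih]
    apply FiberIso.ext_of
    intro r
    simp [FiberIso.trans, FiberIso.symm, Conn.gauge, EdgeTransport.gauge]

theorem Conn.proj_gauge {γ γ' : Graph n M} (h : γ ≤ γ') (g : B.GaugeGroup) (A : B.Conn γ') :
    (A.gauge g).proj h = (A.proj h).gauge g := by
  funext e
  simp only [Conn.proj]
  rw [Equiv.symm_apply_eq, Conn.alongPath_gauge]
  set T := γ.someOrientation.isArc e
  have key : ∀ φ, (((EdgeTransport.equivIso T).symm φ).map _ _ T : B.FiberIso _ _) = φ :=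
    fun φ => (EdgeTransport.equivIso T).apply_symm_apply φ
  change _ = ((g _).symm.trans (((EdgeTransport.equivIso T).symm _).map _ _ T)).trans (g _)
  rw [key]

/-- The projection `𝒜_{γ'} / 𝒢_{γ'} → 𝒜_γ / 𝒢_γ`. -/
def QConn.proj {γ γ' : Graph n M} (h : γ ≤ γ') : B.QConn γ' → B.QConn γ :=
  Quot.map (Conn.proj h) fun _ _ ⟨g, hg⟩ => ⟨g, by rw [hg, Conn.proj_gauge]⟩

theorem Conn.transfer_gauge (Φ : AnalyticDiffeo n M) (τ : ∀ y : M, B.FiberIso (Φ.symm y) y)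
    (g : B.GaugeGroup) {γ : Graph n M} (A : B.Conn γ) :
    (A.gauge g).transfer Φ τ =
      (A.transfer Φ τ).gauge fun y => ((τ y).symm.trans (g (Φ.symm y))).trans (τ y) := by
  funext e
  apply EdgeTransport.ext
  funext x y h
  apply FiberIso.ext_of
  intro r
  simp [Conn.transfer, FiberIso.trans, FiberIso.symm, Conn.gauge, EdgeTransport.gauge]

/-- The map `𝒜_γ / 𝒢_γ → 𝒜_{Φ(γ)} / 𝒢_{Φ(γ)}` defined by an analytic diffeomorphism `Φ`. -/
def QConn.diffeo (Φ : AnalyticDiffeo n M) (b b' : B.Points) {γ : Graph n M} :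
    B.QConn γ → B.QConn (γ.map Φ) :=
  Quot.map (Conn.diffeo Φ b b') fun A _ ⟨g, hg⟩ =>
    ⟨_, (congrArg _ hg).trans (Conn.transfer_gauge Φ _ g A)⟩

end PrincipalBundle

/-! ### Invariant contravariant metrics on the structure group -/

variable (EG) in
/-- The cotangent space of the structure group at `g`. -/
abbrev GCovector (g : G) : Type _ := TangentSpace 𝓘(ℝ, EG) g →L[ℝ] ℝ

variable (EG) in
/-- Pull-back of a covector at `f g` under a map `f : G → G`. -/
def pullG (f : G → G) (g : G) (α : GCovector EG (f g)) : GCovector EG g :=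
  α.comp (mfderiv 𝓘(ℝ, EG) 𝓘(ℝ, EG) f g)

variable (EG G) in
/-- An invariant contravariant metric on `G`: a scalar product in the cotangent space at each
point, invariant under left and right translations. -/
structure InvariantMetric where
  form : ∀ g : G, LinearMap.BilinForm ℝ (GCovector EG g)
  symm : ∀ (g : G) (α β : GCovector EG g), form g α β = form g β α
  pos : ∀ (g : G) (α : GCovector EG g), α ≠ 0 → 0 < form g α α
  left_inv : ∀ (h g : G) (α β : GCovector EG (h * g)),
    form g (pullG EG (fun x => h * x) g α) (pullG EG (fun x => h * x) g β) = form (h * g) α β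
  right_inv : ∀ (h g : G) (α β : GCovector EG (g * h)),
    form g (pullG EG (fun x => x * h) g α) (pullG EG (fun x => x * h) g β) = form (g * h) α β

variable (EG) in
/-- A covector at `h` is carried to the identity of `G` by left translation. -/
def toIdentity (h : G) : GCovector EG h →ₗ[ℝ] GCovector EG (1 : G) where
  toFun α := α.comp
    (mfderiv 𝓘(ℝ, EG) 𝓘(ℝ, EG) (fun x : G => h * x) 1 :
      TangentSpace 𝓘(ℝ, EG) (1 : G) →L[ℝ] TangentSpace 𝓘(ℝ, EG) h)
  map_add' _ _ := rfl
  map_smul' _ _ := rfl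

/-- The pairing of covectors at two points of `G` which are compared by left translation: in terms
of a basis `R_i` of left invariant vector fields it is `k^{ij} α(R_i) β(R_j)`. -/
def InvariantMetric.pair (k : InvariantMetric EG G) (h h' : G) :
    GCovector EG h →ₗ[ℝ] GCovector EG h' →ₗ[ℝ] ℝ :=
  (k.form 1).compl₁₂ (toIdentity EG h) (toIdentity EG h')

namespace PrincipalBundle

variable {B : PrincipalBundle n M EG G EP P} [T2Space M]

/-! ### The natural co-metric -/

/-- The group element which describes the parallel transport of `A` along an edge at `v`, oriented
to be outgoing. -/
def Conn.outgoing (b : B.Points) {γ : Graph n M} (A : B.Conn γ) {v : M} (e : γ.star v) : G :=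
  EdgeTransport.chart b e.isArc (A e.1)

open Classical in
/-- The map `G → 𝒜_e → ∏_{e'} 𝒜_{e'}` through the point `A`: only the component of `A` along the
outgoing edge `e` is varied. -/
def Conn.inject (b : B.Points) {γ : Graph n M} (A : B.Conn γ) {v : M} (e : γ.star v) (g : G) :
    B.Conn γ :=
  Function.update A e.1 ((EdgeTransport.chart b e.isArc).symm g)

theorem Conn.inject_outgoing (b : B.Points) {γ : Graph n M} (A : B.Conn γ) {v : M}
    (e : γ.star v) : A.inject b e (A.outgoing b e) = A := by
  classical
  simp only [Conn.inject, Conn.outgoing, Equiv.symm_apply_apply]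
  exact Function.update_eq_self e.1 A

/-- The covector `ω_e` on `G` defined by a covector `ω` at `A` and an edge `e` outgoing at `v`. -/
def Conn.edgeForm (b : B.Points) {γ : Graph n M} (A : B.Conn γ) {v : M} (e : γ.star v) :
    Covector A →ₗ[ℝ] GCovector EG (A.outgoing b e) where
  toFun α := α.comp
    (mfderiv 𝓘(ℝ, EG) (model EG γ) (A.inject b e) (A.outgoing b e) :
      TangentSpace 𝓘(ℝ, EG) (A.outgoing b e) →L[ℝ] TangentSpace (model EG γ) A)
  map_add' _ _ := rfl
  map_smul' _ _ := rfl

/-- The bilinear form `k_e`. -/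
def kEdge (k : InvariantMetric EG G) (b : B.Points) {γ : Graph n M} (A : B.Conn γ) {v : M}
    (e : γ.star v) : LinearMap.BilinForm ℝ (Covector A) :=
  (k.form (A.outgoing b e)).compl₁₂ (A.edgeForm b e) (A.edgeForm b e)

/-- The bilinear form `k_{ee'}`. -/
def kPair (k : InvariantMetric EG G) (b : B.Points) {γ : Graph n M} (A : B.Conn γ) {v : M}
    (e e' : γ.star v) : LinearMap.BilinForm ℝ (Covector A) :=
  (k.pair (A.outgoing b e) (A.outgoing b e')).compl₁₂ (A.edgeForm b e) (A.edgeForm b e')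

open Classical in
/-- The bilinear form `k_v`; the second sum is over all ordered pairs of edges at `v` which form
an analytic arc at `v`. -/
def kVertex (k : InvariantMetric EG G) (b : B.Points) {γ : Graph n M} (A : B.Conn γ) (v : M) :
    LinearMap.BilinForm ℝ (Covector A) :=
  (1 / 2 : ℝ) • ∑ e : γ.star v, kEdge k b A e +
  (1 / 2 : ℝ) • ∑ e : γ.star v, ∑ e' : γ.star v,
    if FormAnalyticArc n v e.1.1 e'.1.1 then kPair k b A e e' else 0

variable (B) in
/-- A family of real bilinear contravariant tensors, one at each point of each `𝒜_γ`. -/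
def TensorFamily : Type _ :=
  ∀ (γ : Graph n M) (A : B.Conn γ), LinearMap.BilinForm ℝ (Covector A)

/-- The family `k_γ = ∑_v k_v`. -/
def naturalCometric (k : InvariantMetric EG G) (b : B.Points) : B.TensorFamily :=
  fun γ A => ∑ v ∈ γ.vertices, kVertex k b A v

namespace TensorFamily

variable (K : B.TensorFamily)

/-- The map `f : 𝒜_{γ'} → 𝒜_γ` carries the tensor field on `𝒜_{γ'}` to the one on `𝒜_γ`. -/
def CarriedBy {γ γ' : Graph n M} (f : B.Conn γ' → B.Conn γ) : Prop :=
  ∀ (A : B.Conn γ') (α β : Covector (f A)),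
    K γ' A (pullCov f A α) (pullCov f A β) = K γ (f A) α β

/-- Co-metric tensors on the projective limit: consistent families of symmetric tensors. -/
def IsCometric : Prop :=
  (∀ (γ : Graph n M) (A : B.Conn γ) (α β : Covector A), K γ A α β = K γ A β α) ∧
  ∀ (γ γ' : Graph n M) (h : γ ≤ γ'), K.CarriedBy (Conn.proj (B := B) h)

/-- Invariance under all automorphisms of the bundle. -/
def IsNatural : Prop :=
  ∀ (F : B.Automorphism) (γ : Graph n M),
    K.CarriedBy (Conn.automorphism F : B.Conn γ → B.Conn (γ.map F.base))

/-- Invariance under the generalized gauge transformations. -/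
def IsGaugeInvariant : Prop :=
  ∀ (g : B.GaugeGroup) (γ : Graph n M), K.CarriedBy (Conn.gauge g : B.Conn γ → B.Conn γ)

/-- Invariance under the analytic diffeomorphisms of `M`, which act (up to gauge transformations)
through group valued charts. -/
def IsDiffInvariant : Prop :=
  ∀ (Φ : AnalyticDiffeo n M) (b b' : B.Points) (γ : Graph n M),
    K.CarriedBy (Conn.diffeo Φ b b' : B.Conn γ → B.Conn (γ.map Φ))

end TensorFamily

variable (B) in
/-- One-forms on `𝒜_γ`. -/
def OneForm (γ : Graph n M) : Type _ := ∀ A : B.Conn γ, Covector A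

/-- The pull-back of a one-form. -/
def OneForm.pull {γ γ' : Graph n M} (f : B.Conn γ' → B.Conn γ) (α : B.OneForm γ) : B.OneForm γ' :=
  fun A => pullCov f A (α (f A))

/-- Gauge invariant one-forms; they represent the one-forms on the quotient. -/
def OneForm.IsInvariant {γ : Graph n M} (α : B.OneForm γ) : Prop :=
  ∀ g : B.GaugeGroup, α.pull (Conn.gauge g) = α

/-- A family of tensors defines a natural co-metric on the quotient by the generalized gauge
transformations: it is carried to itself by all the representatives of the diffeomorphism action
and, on gauge invariant one-forms it induces operations with values in the functions
on `𝒜_γ / 𝒢_γ`, which are symmetric, consistent with the projections and invariant under the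
action of the analytic diffeomorphisms of `M`. -/
def TensorFamily.DefinesNaturalCometricOnQuotient (K : B.TensorFamily) : Prop :=
  K.IsDiffInvariant ∧
  ∃ Q : ∀ γ : Graph n M, {α : B.OneForm γ // α.IsInvariant} →
      {α : B.OneForm γ // α.IsInvariant} → B.QConn γ → ℝ,
    (∀ γ α β (A : B.Conn γ), Q γ α β A.toQ = K γ A (α.1 A) (β.1 A)) ∧
    (∀ γ α β, Q γ α β = Q γ β α) ∧
    (∀ (γ γ' : Graph n M) (h : γ ≤ γ'),
      ∃ pull : {α : B.OneForm γ // α.IsInvariant} → {α : B.OneForm γ' // α.IsInvariant},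
        (∀ α, (pull α).1 = α.1.pull (Conn.proj h)) ∧
        ∀ α β, Q γ' (pull α) (pull β) = Q γ α β ∘ QConn.proj h) ∧
    (∀ (Φ : AnalyticDiffeo n M) (γ : Graph n M),
      ∃ (pull : {α : B.OneForm (γ.map Φ) // α.IsInvariant} → {α : B.OneForm γ // α.IsInvariant})
        (act : B.QConn γ → B.QConn (γ.map Φ)),
        (∀ (b b' : B.Points) α, (pull α).1 = α.1.pull (Conn.diffeo Φ b b')) ∧
        (∀ b b' : B.Points, act = QConn.diffeo Φ b b') ∧
        ∀ α β, Q γ (pull α) (pull β) = Q (γ.map Φ) α β ∘ act)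

end PrincipalBundle
end Bundle
end FloatingLattice

end

noncomputable section

namespace FloatingLattice

section Bundle

variable {n : ℕ} {M : Type*} [TopologicalSpace M] [ChartedSpace (EuclideanSpace ℝ (Fin n)) M]
  {EG : Type*} [NormedAddCommGroup EG] [NormedSpace ℝ EG]
  {G : Type*} [TopologicalSpace G] [ChartedSpace EG G] [Group G]
  {EP : Type*} [NormedAddCommGroup EP] [NormedSpace ℝ EP]
  {P : Type*} [TopologicalSpace P] [ChartedSpace EP P]

/-! The proof removes the charts from the definition of `k_v`. Let `e` be an edge outgoing at `v`
and `p` a point over `v`. Multiplying the group coordinate of `A` along `e` on the right by `g`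
amounts to preceding the transport along `e` by the automorphism `loop p g` of the fibre over `v`
(`Conn.inject_outgoing_mul`). Hence the covector `ω_e`, moved to the identity by left translation,
is the derivative of `ω` along `g ↦ A.twist e (loop p g)`, called `Conn.loopForm`. The point over
the far end of `e` has disappeared. Replacing `p` by `p a` conjugates the loops by `a`, and a
bi-invariant scalar product is invariant under conjugation at the identity, so `k_v` does not depend
on `p` either (`Conn.form_loopForm`, `kVertex_apply`).

It remains to see how a map `f` between spaces of connections treats twists. If `f` turns twists at
`v'` into twists at `v`, or ignores them, the chain rule identifies the loop forms of a pulled back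
covector and `k_{v'}` goes to `k_v` (`kVertex_pullCov`). Gauge transformations, bundle automorphisms
and the maps given by two group valued charts all have this form; they merely conjugate the twisting
automorphism. So does a projection at a vertex of the coarser graph: each edge of `γ` at `v` begins
with exactly one edge of `γ'`, the remaining edges at `v` are not seen, and forming an analytic arc
depends only on the germs of the edges.

The choice of coefficients in `k_v` matters at a vertex `v` of `γ'` interior to an edge of `γ`. That
edge arrives along `e₁` and leaves along `e₂`; twisting `e₂` by `φ` has the effect of twisting `e₁`
by `φ⁻¹`, so the two loop forms are opposite. The diagonal terms then cancel against those of the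
pairs `(e₁, e₂)` and `(e₂, e₁)` (`kVertex_pullCov_eq_zero_of_pair`). This requires `(e₁, e₂)` to
form an analytic arc, which holds because the composed edge is regular analytic, and `(e₁, e₁)` not
to form one: a regular curve cannot turn back at an end point of an edge
(`not_formAnalyticArc_self`). -/

theorem IsArc.target_unique [T2Space M] {e : Set M} {x y z : M} (h : IsArc n e x y)
    (h' : IsArc n e x z) : z = y :=
  (h.eq_or_eq h'.mem_ends_right).resolve_left h'.ne.symm

namespace PrincipalBundle

variable {B : PrincipalBundle n M EG G EP P}

/-! ### Coordinates of isomorphisms of fibres -/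

theorem Fiber.div_eq_iff {x : M} {p q : B.Fiber x} {g : G} : p.div q = g ↔ p.act g = q :=
  ⟨fun h => by rw [← h, Fiber.act_div], fun h => by rw [← h, Fiber.div_act]⟩

theorem Fiber.div_mul {x : M} (p q r : B.Fiber x) : p.div q * q.div r = p.div r := by
  symm
  rw [Fiber.div_eq_iff, Fiber.act_mul, Fiber.act_div, Fiber.act_div]

theorem Fiber.div_self {x : M} (p : B.Fiber x) : p.div p = 1 := by
  rw [Fiber.div_eq_iff, Fiber.act_one]

theorem Fiber.inv_div {x : M} (p q : B.Fiber x) : (p.div q)⁻¹ = q.div p := by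
  rw [inv_eq_iff_mul_eq_one, Fiber.div_mul, Fiber.div_self]

namespace FiberIso

variable {x y z : M}

variable (B) in
/-- The identity of a fibre. -/
def refl (x : M) : B.FiberIso x x := ⟨Equiv.refl _, fun _ _ => rfl⟩

@[simp]
theorem refl_trans (φ : B.FiberIso x y) : (refl B x).trans φ = φ := rfl

@[simp]
theorem trans_refl (φ : B.FiberIso x y) : φ.trans (refl B y) = φ := rfl

@[simp]
theorem refl_symm : (refl B x).symm = refl B x := rfl

theorem trans_assoc {w : M} (φ : B.FiberIso x y) (ψ : B.FiberIso y z) (χ : B.FiberIso z w) :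
    (φ.trans ψ).trans χ = φ.trans (ψ.trans χ) := rfl

theorem symm_trans (φ : B.FiberIso x y) (ψ : B.FiberIso y z) :
    (φ.trans ψ).symm = ψ.symm.trans φ.symm := rfl

@[simp]
theorem self_trans_symm (φ : B.FiberIso x y) : φ.trans φ.symm = refl B x :=
  ext_of fun p => φ.1.symm_apply_apply p

@[simp]
theorem trans_symm_trans (φ : B.FiberIso x y) (ψ : B.FiberIso x z) :
    φ.trans (φ.symm.trans ψ) = ψ := by
  rw [← trans_assoc, self_trans_symm, refl_trans]

theorem coord_apply (p : B.Fiber x) (q : B.Fiber y) (φ : B.FiberIso x y) :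
    coord p q φ = q.div (φ.1 p) := rfl

theorem act_coord (p : B.Fiber x) (q : B.Fiber y) (φ : B.FiberIso x y) :
    q.act (coord p q φ) = φ.1 p := Fiber.act_div _ _

theorem coord_trans (p : B.Fiber x) (q : B.Fiber y) (r : B.Fiber z) (φ : B.FiberIso x y)
    (ψ : B.FiberIso y z) : coord p r (φ.trans ψ) = coord q r ψ * coord p q φ := by
  rw [coord_apply, Fiber.div_eq_iff, Fiber.act_mul, act_coord, ← ψ.2, act_coord]
  rfl

theorem coord_refl (p q : B.Fiber x) : coord p q (refl B x) = q.div p := rfl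

theorem coord_symm (p : B.Fiber x) (q : B.Fiber y) (φ : B.FiberIso x y) :
    coord q p φ.symm = (coord p q φ)⁻¹ := by
  rw [eq_inv_iff_mul_eq_one, ← coord_trans, self_trans_symm, coord_refl, Fiber.div_self]

theorem coord_change (p p' : B.Fiber x) (q q' : B.Fiber y) (φ : B.FiberIso x y) :
    coord p' q' φ = q'.div q * coord p q φ * p.div p' := by
  rw [← trans_refl φ, coord_trans p' q q', coord_refl, ← refl_trans φ, coord_trans p' p q,
    coord_refl, refl_trans, trans_refl, mul_assoc]

/-- The automorphism of a fibre which carries the point `p` to `p x`. -/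
def loop (p : B.Fiber x) (g : G) : B.FiberIso x x := (coord p p).symm g

@[simp]
theorem coord_loop (p : B.Fiber x) (g : G) : coord p p (loop p g) = g :=
  (coord p p).apply_symm_apply g

theorem loop_one (p : B.Fiber x) : loop p 1 = refl B x := by
  rw [loop, Equiv.symm_apply_eq, coord_refl, Fiber.div_self]

theorem loop_symm (p : B.Fiber x) (g : G) : (loop p g).symm = loop p g⁻¹ := by
  apply (coord p p).injective
  rw [coord_symm p p, coord_loop, coord_loop]

theorem loop_act (p : B.Fiber x) (a g : G) : loop (p.act a) g = loop p (a * g * a⁻¹) := by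
  apply (coord p p).injective
  rw [coord_loop, coord_change (p.act a) p (p.act a) p, coord_loop, Fiber.div_act,
    ← Fiber.inv_div, Fiber.div_act]

theorem loop_conj (p : B.Fiber x) (τ : B.FiberIso x y) (g : G) :
    (τ.symm.trans (loop p g)).trans τ = loop (τ.1 p) g := by
  have h : coord p (τ.1 p) τ = 1 := by rw [coord_apply, Fiber.div_self]
  apply (coord (τ.1 p) (τ.1 p)).injective
  rw [coord_loop, coord_trans _ p, coord_trans _ p, coord_symm p, h, coord_loop]
  simp

end FiberIso

/-! ### Connections -/

variable [T2Space M]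

theorem EdgeTransport.ext_map {e : Set M} {x y : M} (h : IsArc n e x y)
    {T T' : B.EdgeTransport e} (hT : T.map x y h = T'.map x y h) : T = T' :=
  (EdgeTransport.equivIso h).injective hT

open Classical in
/-- The gauge transformation which acts by `φ` on the fibre over `v` and trivially on all other
fibres. -/
def localGauge {v : M} (φ : B.FiberIso v v) : B.GaugeGroup :=
  Function.update (fun x => FiberIso.refl B x) v φ

@[simp]
theorem localGauge_self {v : M} (φ : B.FiberIso v v) : localGauge φ v = φ := by
  simp [localGauge]

theorem localGauge_of_ne {v x : M} (φ : B.FiberIso v v) (h : x ≠ v) :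
    localGauge φ x = FiberIso.refl B x := by
  classical
  exact Function.update_of_ne h _ _

open Classical in
/-- The connection which differs from `A` only along the edge `e`, where the parallel transport
starting at `v` is preceded by the automorphism `φ` of the fibre over `v`. -/
def Conn.twist {γ : Graph n M} (A : B.Conn γ) (e : γ.edges) {v : M} (φ : B.FiberIso v v) :
    B.Conn γ :=
  Function.update A e ((A e).gauge (localGauge φ.symm))

namespace Conn

variable {γ γ' : Graph n M}

@[ext]
theorem ext_map {A A' : B.Conn γ} (h : ∀ e x y hxy, (A e).map x y hxy = (A' e).map x y hxy) :
    A = A' :=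
  funext fun e => EdgeTransport.ext (by funext x y hxy; exact h e x y hxy)

theorem twist_same (A : B.Conn γ) (e : γ.edges) {v : M} (φ : B.FiberIso v v) :
    A.twist e φ e = (A e).gauge (localGauge φ.symm) := by
  classical
  exact Function.update_self e _ A

theorem twist_of_ne (A : B.Conn γ) {e e' : γ.edges} {v : M} (φ : B.FiberIso v v) (h : e' ≠ e) :
    A.twist e φ e' = A e' := by
  classical
  exact Function.update_of_ne h _ A

theorem twist_map_of_ne (A : B.Conn γ) (e e' : γ.edges) {v x y : M} (φ : B.FiberIso v v)
    (h : IsArc n e'.1 x y) (hx : x ≠ v) (hy : y ≠ v) :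
    (A.twist e φ e').map x y h = (A e').map x y h := by
  by_cases hee : e' = e
  · subst hee
    rw [twist_same]
    simp only [EdgeTransport.gauge]
    rw [localGauge_of_ne _ hx, localGauge_of_ne _ hy]
    rfl
  · rw [twist_of_ne _ _ hee]

theorem twist_map_left (A : B.Conn γ) (e : γ.edges) {v y : M} (φ : B.FiberIso v v)
    (h : IsArc n e.1 v y) : (A.twist e φ e).map v y h = φ.trans ((A e).map v y h) := by
  rw [twist_same]
  simp only [EdgeTransport.gauge]
  rw [localGauge_self, localGauge_of_ne _ h.ne.symm]
  rfl

theorem twist_map_right (A : B.Conn γ) (e : γ.edges) {v y : M} (φ : B.FiberIso v v)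
    (h : IsArc n e.1 y v) : (A.twist e φ e).map y v h = ((A e).map y v h).trans φ.symm := by
  rw [twist_same]
  simp only [EdgeTransport.gauge]
  rw [localGauge_self, localGauge_of_ne _ h.ne]
  rfl

theorem twist_refl (A : B.Conn γ) (e : γ.edges) (v : M) : A.twist e (FiberIso.refl B v) = A := by
  have h : (localGauge (FiberIso.refl B v).symm : B.GaugeGroup) = fun x => FiberIso.refl B x := by
    funext x
    simp [localGauge]
  rw [twist, h]
  exact Function.update_eq_self e A

/-- The gauged transport starts with `(g v)⁻¹`; moving the twist `φ` in front of this factor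
conjugates it by `g v`. -/
theorem gauge_twist (g : B.GaugeGroup) (A : B.Conn γ) {v : M} (e : γ.star v)
    (φ : B.FiberIso v v) :
    (A.twist e.1 φ).gauge g = (A.gauge g).twist e.1 (((g v).symm.trans φ).trans (g v)) := by
  funext e'
  by_cases h : e' = e.1
  · subst h
    apply EdgeTransport.ext_map e.isArc
    rw [twist_map_left]
    change ((g v).symm.trans ((A.twist e.1 φ e.1).map _ _ _)).trans (g _) = _
    rw [twist_map_left]
    change _ = FiberIso.trans _ (((g v).symm.trans ((A e.1).map _ _ _)).trans (g _))
    simp only [FiberIso.trans_assoc, FiberIso.trans_symm_trans]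
  · rw [twist_of_ne _ _ h]
    change (A.twist e.1 φ e').gauge g = _
    rw [twist_of_ne _ _ h]
    rfl

/-- The edge `Φ(e)` of `Φ(γ)`. -/
def _root_.FloatingLattice.Graph.mapEdge (Φ : AnalyticDiffeo n M) (e : γ.edges) :
    (γ.map Φ).edges :=
  ⟨Φ '' e.1, by classical exact Finset.mem_image_of_mem _ e.2⟩

theorem transfer_map (Φ : AnalyticDiffeo n M) (τ : ∀ y : M, B.FiberIso (Φ.symm y) y)
    (A : B.Conn γ) {e : Set M} (he : e ∈ γ.edges) {e' : Set M} (he' : e' ∈ (γ.map Φ).edges)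
    (hee : Φ ⁻¹' e' = e) {x y : M} (h : IsArc n e' x y)
    (h' : IsArc n e (Φ.symm x) (Φ.symm y)) :
    (A.transfer Φ τ ⟨e', he'⟩).map x y h =
      ((τ x).symm.trans ((A ⟨e, he⟩).map _ _ h')).trans (τ y) := by
  subst hee
  rfl

theorem transfer_twist (Φ : AnalyticDiffeo n M) (τ : ∀ y : M, B.FiberIso (Φ.symm y) y)
    (A : B.Conn γ) {v : M} (e : γ.star (Φ.symm v)) (φ : B.FiberIso (Φ.symm v) (Φ.symm v)) :
    (A.twist e.1 φ).transfer Φ τ =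
      (A.transfer Φ τ).twist (Graph.mapEdge Φ e.1) (((τ v).symm.trans φ).trans (τ v)) := by
  funext e'
  by_cases h : e' = Graph.mapEdge Φ e.1
  · subst h
    obtain ⟨y, hy⟩ : ∃ y, e.target = Φ.symm y := ⟨Φ e.target, by simp⟩
    have harc : IsArc n e.1.1 (Φ.symm v) (Φ.symm y) := hy ▸ e.isArc
    have harc' : IsArc n (Graph.mapEdge Φ e.1).1 v y := by
      have := harc.map Φ
      rwa [Φ.apply_symm_apply, Φ.apply_symm_apply] at this
    apply EdgeTransport.ext_map harc'
    have hpre : Φ ⁻¹' (Graph.mapEdge Φ e.1).1 = e.1.1 := preimage_image_diffeo Φ _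
    rw [twist_map_left]
    rw [transfer_map Φ τ (A.twist e.1 φ) e.1.2 (Graph.mapEdge Φ e.1).2 hpre harc' harc]
    rw [transfer_map Φ τ A e.1.2 (Graph.mapEdge Φ e.1).2 hpre harc' harc]
    rw [twist_map_left]
    simp only [FiberIso.trans_assoc, FiberIso.trans_symm_trans]
  · rw [twist_of_ne _ _ h]
    have hne : (⟨Φ ⁻¹' e'.1, Graph.preimage_mem e'.2⟩ : γ.edges) ≠ e.1 := by
      intro h'
      apply h
      apply Subtype.ext
      change e'.1 = Φ '' e.1.1
      rw [← h']
      exact (image_preimage_eq e'.1 Φ.surjective).symm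
    apply EdgeTransport.ext
    funext x y hxy
    simp only [transfer]
    rw [twist_of_ne _ _ hne]

/-- `coord_trans` reverses the order of composition, so a factor on the right of the coordinate is
an automorphism applied first, at the vertex `v`. -/
theorem inject_outgoing_mul (b : B.Points) (A : B.Conn γ) {v : M} (e : γ.star v) (g : G) :
    A.inject b e (A.outgoing b e * g) = A.twist e.1 (FiberIso.loop (b v) g) := by
  classical
  rw [inject, twist]
  congr 1
  rw [Equiv.symm_apply_eq]
  have h := A.twist_map_left e.1 (FiberIso.loop (b v) g) e.isArc
  rw [twist_same] at h
  change _ = FiberIso.coord (b v) (b e.target)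
    (((A e.1).gauge (localGauge (FiberIso.loop (b v) g).symm)).map _ _ e.isArc)
  rw [h, FiberIso.coord_trans _ (b v), FiberIso.coord_loop]
  rfl

/-- Two lifts of `Φ` to the fibres differ by a family of automorphisms of single fibres. This makes
the action on the quotients independent of the points chosen. -/
theorem transfer_eq_gauge (Φ : AnalyticDiffeo n M) (τ τ' : ∀ y : M, B.FiberIso (Φ.symm y) y)
    (A : B.Conn γ) :
    A.transfer Φ τ' = (A.transfer Φ τ).gauge fun y => (τ y).symm.trans (τ' y) := by
  ext e x y h : 4
  simp only [transfer, gauge, EdgeTransport.gauge, FiberIso.symm_trans, FiberIso.symm_symm,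
    FiberIso.trans_assoc, FiberIso.trans_symm_trans]

end Conn

end PrincipalBundle

end Bundle

section Bundle

variable {n : ℕ} {M : Type*} [TopologicalSpace M] [ChartedSpace (EuclideanSpace ℝ (Fin n)) M]
  {EG : Type*} [NormedAddCommGroup EG] [NormedSpace ℝ EG]
  {G : Type*} [TopologicalSpace G] [ChartedSpace EG G] [Group G]
  {EP : Type*} [NormedAddCommGroup EP] [NormedSpace ℝ EP]
  {P : Type*} [TopologicalSpace P] [ChartedSpace EP P]

namespace PrincipalBundle

variable {B : PrincipalBundle n M EG G EP P} [T2Space M] {γ γ' : Graph n M}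

/-! ### Smooth maps into and between spaces of connections -/

section Smooth

variable {E : Type*} [NormedAddCommGroup E] [NormedSpace ℝ E] {H : Type*} [TopologicalSpace H]
  {I : ModelWithCorners ℝ E H} {N : Type*} [TopologicalSpace N] [ChartedSpace H N]

/-- The structure of `B.Conn γ` is transported from the product by `someChart`, so its extended
charts are, component by component and definitionally, those of `G`. -/
theorem Conn.contMDiff_iff {f : N → B.Conn γ} :
    ContMDiff I (model EG γ) ∞ f ↔
      ∀ e, ContMDiff I 𝓘(ℝ, EG) ∞ fun x => Conn.someChart B γ (f x) e := by
  have hcont : ∀ x, ContinuousAt f x ↔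
      ∀ e, ContinuousAt (fun x => Conn.someChart B γ (f x) e) x := by
    intro x
    rw [← continuousAt_pi]
    exact (Conn.homeo B γ).comp_continuousAt_iff f x |>.symm
  have hext : ∀ x, ContDiffWithinAt ℝ ∞ (extChartAt (model EG γ) (f x) ∘ f ∘ (extChartAt I x).symm)
      (range I) (extChartAt I x x) ↔ ∀ e, ContDiffWithinAt ℝ ∞
        (extChartAt 𝓘(ℝ, EG) (Conn.someChart B γ (f x) e) ∘
          (fun x => Conn.someChart B γ (f x) e) ∘ (extChartAt I x).symm)
        (range I) (extChartAt I x x) := fun x => contDiffWithinAt_pi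
  constructor
  · intro h e x
    have hx := contMDiffAt_iff.1 (h x)
    exact contMDiffAt_iff.2 ⟨(hcont x).1 hx.1 e, (hext x).1 hx.2 e⟩
  · intro h x
    exact contMDiffAt_iff.2 ⟨(hcont x).2 fun e => (contMDiffAt_iff.1 (h e x)).1,
      (hext x).2 fun e => (contMDiffAt_iff.1 (h e x)).2⟩

variable [LieGroup 𝓘(ℝ, EG) ∞ G]

/-- A family of isomorphisms of two fibres is smooth if its group valued coordinates are. -/
def FiberIso.Smooth (I : ModelWithCorners ℝ E H) {x y : M} (φ : N → B.FiberIso x y) : Prop :=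
  ∀ (p : B.Fiber x) (q : B.Fiber y), ContMDiff I 𝓘(ℝ, EG) ∞ fun t => FiberIso.coord p q (φ t)

namespace FiberIso

variable {x y z : M}

/-- Changing the reference points multiplies the coordinate on both sides by constants. -/
theorem smooth_of_coord {φ : N → B.FiberIso x y} (p : B.Fiber x) (q : B.Fiber y)
    (h : ContMDiff I 𝓘(ℝ, EG) ∞ fun t => coord p q (φ t)) : Smooth I φ := by
  intro p' q'
  have : (fun t => coord p' q' (φ t)) = fun t => q'.div q * coord p q (φ t) * p.div p' :=
    funext fun t => coord_change p p' q q' (φ t)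
  rw [this]
  exact (contMDiff_const.mul h).mul contMDiff_const

theorem smooth_const (φ : B.FiberIso x y) : Smooth I fun _ : N => φ :=
  fun _ _ => contMDiff_const

theorem Smooth.trans {φ : N → B.FiberIso x y} {ψ : N → B.FiberIso y z} (hφ : Smooth I φ)
    (hψ : Smooth I ψ) : Smooth I fun t => (φ t).trans (ψ t) := by
  intro p r
  obtain ⟨q⟩ := Fiber.nonempty (B := B) y
  simp only [coord_trans p q r]
  exact (hψ q r).mul (hφ p q)

theorem Smooth.symm {φ : N → B.FiberIso x y} (hφ : Smooth I φ) :
    Smooth I fun t => (φ t).symm := by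
  intro q p
  simp only [coord_symm p q]
  exact (hφ p q).inv

theorem smooth_loop (p : B.Fiber x) : Smooth 𝓘(ℝ, EG) (loop p) := by
  apply smooth_of_coord p p
  simp only [coord_loop]
  exact contMDiff_id

end FiberIso

/-- One orientation of each edge suffices, since reversing it inverts the coordinate. The
orientation used by the chart of `B.Conn γ` thus never has to be matched. -/
theorem Conn.contMDiff_of_smooth {f : N → B.Conn γ}
    (hf : ∀ e : γ.edges, ∃ (x y : M) (h : IsArc n e.1 x y),
      FiberIso.Smooth I fun t => (f t e).map x y h) :
    ContMDiff I (model EG γ) ∞ f := by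
  rw [Conn.contMDiff_iff]
  intro e
  obtain ⟨x, y, h, hxy⟩ := hf e
  have key : ∀ (x' y' : M) (h' : IsArc n e.1 x' y'),
      FiberIso.Smooth I fun t => (f t e).map x' y' h' := by
    intro x' y' h'
    rcases h.eq_or_eq h'.mem_ends_left with hx | hx
    · subst hx
      obtain rfl := h.target_unique h'
      exact hxy
    · subst hx
      obtain rfl := h.symm.target_unique h'
      simpa only [← EdgeTransport.map_symm] using hxy.symm
  exact key _ _ (γ.someOrientation.isArc e) _ _

theorem Conn.smooth_map (e : γ.edges) {x y : M} (h : IsArc n e.1 x y) :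
    FiberIso.Smooth (model EG γ) fun A : B.Conn γ => (A e).map x y h := by
  have harc := γ.someOrientation.isArc e
  have h0 : FiberIso.Smooth (model EG γ) fun A : B.Conn γ => (A e).map _ _ harc :=
    FiberIso.smooth_of_coord (B.nonempty_points.some _) (B.nonempty_points.some _)
      (Conn.contMDiff_iff.1 contMDiff_id e)
  rcases harc.eq_or_eq h.mem_ends_left with hx | hx
  · subst hx
    obtain rfl := harc.target_unique h
    exact h0
  · subst hx
    obtain rfl := harc.symm.target_unique h
    simpa only [← EdgeTransport.map_symm] using h0.symm

theorem Conn.contMDiff_twist_loop (A : B.Conn γ) {v : M} (e : γ.star v) (p : B.Fiber v) :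
    ContMDiff 𝓘(ℝ, EG) (model EG γ) ∞ fun g => A.twist e.1 (FiberIso.loop p g) := by
  refine Conn.contMDiff_of_smooth fun e' => ?_
  by_cases h : e' = e.1
  · subst h
    refine ⟨_, _, e.isArc, ?_⟩
    simp only [Conn.twist_map_left]
    exact (FiberIso.smooth_loop p).trans (FiberIso.smooth_const _)
  · refine ⟨_, _, γ.someOrientation.isArc e', ?_⟩
    simp only [Conn.twist_of_ne _ _ h]
    exact FiberIso.smooth_const _

theorem Conn.contMDiff_gauge (g : B.GaugeGroup) :
    ContMDiff (model EG γ) (model EG γ) ∞ (Conn.gauge g : B.Conn γ → B.Conn γ) :=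
  Conn.contMDiff_of_smooth fun e => ⟨_, _, γ.someOrientation.isArc e,
    ((FiberIso.smooth_const _).trans (Conn.smooth_map e _)).trans (FiberIso.smooth_const _)⟩

theorem Conn.contMDiff_transfer (Φ : AnalyticDiffeo n M)
    (τ : ∀ y : M, B.FiberIso (Φ.symm y) y) :
    ContMDiff (model EG γ) (model EG (γ.map Φ)) ∞
      (Conn.transfer Φ τ : B.Conn γ → B.Conn (γ.map Φ)) :=
  Conn.contMDiff_of_smooth fun e => ⟨_, _, (γ.map Φ).someOrientation.isArc e,
    ((FiberIso.smooth_const _).trans (Conn.smooth_map _ _)).trans (FiberIso.smooth_const _)⟩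

theorem Conn.smooth_alongPath {x y : M} (p : GraphPath γ x y) :
    FiberIso.Smooth (model EG γ) fun A : B.Conn γ => A.alongPath p := by
  induction p with
  | single e h => exact Conn.smooth_map e h
  | cons e h p ih => exact (Conn.smooth_map e h).trans ih

/-- The string of edges of `γ'` by which the projection on `γ` is defined. -/
def _root_.FloatingLattice.Graph.subdivision (h : γ ≤ γ') (e : γ.edges) :
    GraphPath γ' (γ.someOrientation.src e) (γ.someOrientation.tgt e) :=
  (h.1 e.1 e.2 _ _ (γ.someOrientation.isArc e)).choose

theorem _root_.FloatingLattice.Graph.subdivision_composes (h : γ ≤ γ') (e : γ.edges) :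
    (Graph.subdivision h e).Composes e.1 :=
  (h.1 e.1 e.2 _ _ (γ.someOrientation.isArc e)).choose_spec

theorem Conn.proj_map (h : γ ≤ γ') (A : B.Conn γ') (e : γ.edges) :
    (A.proj h e).map _ _ (γ.someOrientation.isArc e) = A.alongPath (Graph.subdivision h e) :=
  (EdgeTransport.equivIso (γ.someOrientation.isArc e)).apply_symm_apply _

theorem Conn.contMDiff_proj (h : γ ≤ γ') :
    ContMDiff (model EG γ') (model EG γ) ∞ (Conn.proj h : B.Conn γ' → B.Conn γ) := by
  refine Conn.contMDiff_of_smooth fun e => ⟨_, _, γ.someOrientation.isArc e, ?_⟩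
  simp only [Conn.proj_map]
  exact Conn.smooth_alongPath _

end Smooth

end PrincipalBundle

end Bundle

section Bundle

variable {n : ℕ} {M : Type*} [TopologicalSpace M] [ChartedSpace (EuclideanSpace ℝ (Fin n)) M]
  {EG : Type*} [NormedAddCommGroup EG] [NormedSpace ℝ EG]
  {G : Type*} [TopologicalSpace G] [ChartedSpace EG G] [Group G] [LieGroup 𝓘(ℝ, EG) ∞ G]
  {EP : Type*} [NormedAddCommGroup EP] [NormedSpace ℝ EP]
  {P : Type*} [TopologicalSpace P] [ChartedSpace EP P]

/-! ### Derivatives of the group operations -/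

theorem mdifferentiable_mul_left (a : G) :
    MDifferentiable 𝓘(ℝ, EG) 𝓘(ℝ, EG) fun x : G => a * x :=
  (contMDiff_mul_left (I := 𝓘(ℝ, EG)) (n := ∞) (a := a)).mdifferentiable (by simp)

theorem mdifferentiable_mul_right (a : G) :
    MDifferentiable 𝓘(ℝ, EG) 𝓘(ℝ, EG) fun x : G => x * a :=
  (contMDiff_mul_right (I := 𝓘(ℝ, EG)) (n := ∞) (a := a)).mdifferentiable (by simp)

theorem mdifferentiable_inv : MDifferentiable 𝓘(ℝ, EG) 𝓘(ℝ, EG) fun x : G => x⁻¹ :=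
  (contMDiff_inv 𝓘(ℝ, EG) ∞).mdifferentiable (by simp)

/-- Differentiate `x * x⁻¹ = 1` at the identity, where the derivative of multiplication is the sum
of the two projections. -/
theorem mfderiv_inv_one :
    (mfderiv 𝓘(ℝ, EG) 𝓘(ℝ, EG) (fun x : G => x⁻¹) 1 : EG →L[ℝ] EG) =
      -ContinuousLinearMap.id ℝ EG := by
  set D : EG →L[ℝ] EG := mfderiv 𝓘(ℝ, EG) 𝓘(ℝ, EG) (fun x : G => x⁻¹) 1
  have hμ : MDifferentiableAt (𝓘(ℝ, EG).prod 𝓘(ℝ, EG)) 𝓘(ℝ, EG)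
      (fun z : G × G => z.1 * z.2) (1, 1) :=
    (contMDiff_mul 𝓘(ℝ, EG) ∞).mdifferentiable (by simp) _
  have hpair := mdifferentiableAt_id.prodMk (mdifferentiable_inv (EG := EG) (1 : G))
  have hμ' : (mfderiv (𝓘(ℝ, EG).prod 𝓘(ℝ, EG)) 𝓘(ℝ, EG) (fun z : G × G => z.1 * z.2) (1, 1) :
      EG × EG →L[ℝ] EG) =
        ContinuousLinearMap.fst ℝ EG EG + ContinuousLinearMap.snd ℝ EG EG := by
    refine (mfderiv_prod_eq_add hμ).trans ?_
    have h1 : (fun z : G × G => z.1 * (1 : G)) = Prod.fst := funext fun z => mul_one z.1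
    have h2 : (fun z : G × G => (1 : G) * z.2) = Prod.snd := funext fun z => one_mul z.2
    have hd : ∀ f f' : G × G → G, f = f' →
        (mfderiv (𝓘(ℝ, EG).prod 𝓘(ℝ, EG)) 𝓘(ℝ, EG) f (1, 1) : EG × EG →L[ℝ] EG) =
          mfderiv (𝓘(ℝ, EG).prod 𝓘(ℝ, EG)) 𝓘(ℝ, EG) f' (1, 1) := fun _ _ h => by rw [h]
    exact congrArg₂ (fun a b : EG × EG →L[ℝ] EG => a + b) ((hd _ _ h1).trans mfderiv_fst)
      ((hd _ _ h2).trans mfderiv_snd)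
  have hpair' : (mfderiv 𝓘(ℝ, EG) (𝓘(ℝ, EG).prod 𝓘(ℝ, EG)) (fun x : G => (x, x⁻¹)) 1 :
      EG →L[ℝ] EG × EG) = (ContinuousLinearMap.id ℝ EG).prod D :=
    (mdifferentiableAt_id.mfderiv_prod (mdifferentiable_inv (EG := EG) (1 : G))).trans
      (congrArg (fun a : EG →L[ℝ] EG => a.prod D) mfderiv_id)
  have hcomp := mfderiv_comp_of_eq (x := (1 : G)) hμ hpair (by simp)
  have hconst : ((fun z : G × G => z.1 * z.2) ∘ fun x : G => (id x, x⁻¹)) = fun _ => 1 := by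
    funext x
    simp
  rw [hconst] at hcomp
  have h0 : (0 : EG →L[ℝ] EG) = (ContinuousLinearMap.fst ℝ EG EG +
      ContinuousLinearMap.snd ℝ EG EG).comp ((ContinuousLinearMap.id ℝ EG).prod D) := by
    rw [← hμ', ← hpair']
    refine mfderiv_const.symm.trans (hcomp.trans ?_)
    -- The chain rule produces the derivative of multiplication at `(1, 1⁻¹)`; the base point has to
    -- be moved to `(1, 1)`.
    have hd : ∀ y : G, y = 1 →
        (mfderiv (𝓘(ℝ, EG).prod 𝓘(ℝ, EG)) 𝓘(ℝ, EG) (fun z : G × G => z.1 * z.2) (1, y) :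
          EG × EG →L[ℝ] EG) =
            mfderiv (𝓘(ℝ, EG).prod 𝓘(ℝ, EG)) 𝓘(ℝ, EG) (fun z : G × G => z.1 * z.2) (1, 1) :=
      fun _ h => by rw [h]
    exact congrArg (fun a : EG × EG →L[ℝ] EG => a.comp (mfderiv 𝓘(ℝ, EG)
      (𝓘(ℝ, EG).prod 𝓘(ℝ, EG)) (fun x : G => (x, x⁻¹)) 1 : EG →L[ℝ] EG × EG)) (hd _ inv_one)
  refine ContinuousLinearMap.ext fun w => ?_
  have hw : 0 = w + D w := DFunLike.congr_fun h0 w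
  exact (neg_eq_of_add_eq_zero_right hw.symm).symm

theorem pullG_comp (f h : G → G) (g : G) (hf : MDifferentiable 𝓘(ℝ, EG) 𝓘(ℝ, EG) f)
    (hh : MDifferentiable 𝓘(ℝ, EG) 𝓘(ℝ, EG) h) (α : GCovector EG (f (h g))) :
    pullG EG h g (pullG EG f (h g) α) = pullG EG (f ∘ h) g α := by
  unfold pullG
  rw [mfderiv_comp g (hf _) (hh _)]
  rfl

/-- All cotangent spaces unfold to `EG →L[ℝ] ℝ`, so a base point may be replaced by an equal one
while the covectors stay as they are. -/
theorem InvariantMetric.form_congr (k : InvariantMetric EG G) {g h : G} (hgh : g = h)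
    (α β : EG →L[ℝ] ℝ) :
    k.form g (α : GCovector EG g) (β : GCovector EG g) =
      k.form h (α : GCovector EG h) (β : GCovector EG h) := by
  subst hgh
  rfl

/-- By left invariance, `k_e` is computed at the identity just as `k_{ee'}` is by definition. -/
theorem InvariantMetric.form_toIdentity (k : InvariantMetric EG G) (g : G)
    (α β : GCovector EG g) :
    k.form 1 (toIdentity EG g α) (toIdentity EG g β) = k.form g α β :=
  (k.left_inv g 1 α β).trans (k.form_congr (mul_one g) α β)

/-- The scalar product at the identity is invariant under the coadjoint action. -/
theorem InvariantMetric.form_conj (k : InvariantMetric EG G) (a : G) (α β : GCovector EG (1 : G)) :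
    k.form 1 (pullG EG (fun x => a * x * a⁻¹) 1 α) (pullG EG (fun x => a * x * a⁻¹) 1 β) =
      k.form 1 α β := by
  have h1 : a * 1 * a⁻¹ = 1 := by simp
  -- Conjugation is left translation by `a` followed by right translation by `a⁻¹`; each preserves
  -- `k`.
  have hcomp : ∀ α : EG →L[ℝ] ℝ, (pullG EG (fun x => a * x * a⁻¹) 1 α : EG →L[ℝ] ℝ) =
      pullG EG (fun x => a * x) 1 (pullG EG (fun x => x * a⁻¹) (a * 1) α) := fun α =>
    (pullG_comp (fun x => x * a⁻¹) (fun x => a * x) 1 (mdifferentiable_mul_right _)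
      (mdifferentiable_mul_left _) α).symm
  have h := (k.left_inv a 1 _ _).trans
    (k.right_inv a⁻¹ (a * 1) (α : EG →L[ℝ] ℝ) (β : EG →L[ℝ] ℝ))
  rw [← hcomp α, ← hcomp β] at h
  exact h.trans (k.form_congr h1 α β)

namespace PrincipalBundle

variable {B : PrincipalBundle n M EG G EP P} [T2Space M] {γ γ' : Graph n M}

/-! ### Covectors in terms of automorphisms of the fibres -/

/-- Pull-back of a covector at `A` under a map `u` from the structure group with `u 1 = A`. -/
def Conn.pullAlong (u : G → B.Conn γ) {A : B.Conn γ} (_ : u 1 = A) :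
    Covector A →ₗ[ℝ] GCovector EG (1 : G) where
  toFun α := α.comp
    (mfderiv 𝓘(ℝ, EG) (model EG γ) u 1 :
      TangentSpace 𝓘(ℝ, EG) (1 : G) →L[ℝ] TangentSpace (model EG γ) A)
  map_add' _ _ := rfl
  map_smul' _ _ := rfl

/-- The chain rule. The composite has its own name `w` so that it can be given as an explicit family
of twists of `f A`. -/
theorem Conn.pullAlong_pullCov {f : B.Conn γ' → B.Conn γ}
    (hf : MDifferentiable (model EG γ') (model EG γ) f) {u : G → B.Conn γ'} {A : B.Conn γ'}
    (hu : u 1 = A) (hud : MDifferentiable 𝓘(ℝ, EG) (model EG γ') u) {w : G → B.Conn γ}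
    (hw : w 1 = f A) (hfu : ∀ g, f (u g) = w g) (α : Covector (f A)) :
    Conn.pullAlong u hu (pullCov f A α) = Conn.pullAlong w hw α := by
  subst hu
  obtain rfl : f ∘ u = w := funext hfu
  exact (congrArg (fun D : EG →L[ℝ] (γ.edges → EG) => (α : (γ.edges → EG) →L[ℝ] ℝ).comp D)
    (mfderiv_comp 1 (hf _) (hud _))).symm

theorem Conn.pullAlong_const {A : B.Conn γ} (α : Covector A) :
    Conn.pullAlong (fun _ : G => A) rfl α = 0 := by
  refine (congrArg (fun D : EG →L[ℝ] (γ.edges → EG) => (α : (γ.edges → EG) →L[ℝ] ℝ).comp D)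
    mfderiv_const).trans ?_
  exact ContinuousLinearMap.comp_zero _

theorem Conn.pullAlong_comp {u : G → B.Conn γ} {A : B.Conn γ} (hu : u 1 = A)
    (hud : MDifferentiable 𝓘(ℝ, EG) (model EG γ) u) {f : G → G} (hf1 : f 1 = 1)
    (hf : MDifferentiable 𝓘(ℝ, EG) 𝓘(ℝ, EG) f) {w : G → B.Conn γ} (hw : w 1 = A)
    (huw : ∀ g, u (f g) = w g) (α : Covector A) :
    Conn.pullAlong w hw α = (Conn.pullAlong u hu α : EG →L[ℝ] ℝ).comp
      (mfderiv 𝓘(ℝ, EG) 𝓘(ℝ, EG) f 1 : EG →L[ℝ] EG) := by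
  subst hu
  obtain rfl : u ∘ f = w := funext huw
  have h := mfderiv_comp_of_eq (hud _) (hf _) hf1
  rw [hf1] at h
  exact congrArg (fun D : EG →L[ℝ] (γ.edges → EG) => (α : (γ.edges → EG) →L[ℝ] ℝ).comp D) h

/-- Inversion has derivative `-1` at the identity. This is the source of the minus sign in the
cancellation at subdividing vertices. -/
theorem Conn.pullAlong_inv {u : G → B.Conn γ} {A : B.Conn γ} (hu : u 1 = A)
    (hud : MDifferentiable 𝓘(ℝ, EG) (model EG γ) u) {w : G → B.Conn γ} (hw : w 1 = A)
    (huw : ∀ g, u g⁻¹ = w g) (α : Covector A) :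
    Conn.pullAlong w hw α = -Conn.pullAlong u hu α := by
  rw [Conn.pullAlong_comp hu hud inv_one mdifferentiable_inv hw huw, mfderiv_inv_one]
  exact (ContinuousLinearMap.comp_neg _ _).trans
    (congrArg Neg.neg (ContinuousLinearMap.comp_id _))

theorem Conn.twist_loop_one (A : B.Conn γ) {v : M} (e : γ.edges) (p : B.Fiber v) :
    A.twist e (FiberIso.loop p 1) = A := by
  rw [FiberIso.loop_one, Conn.twist_refl]

theorem Conn.mdifferentiable_twist_loop (A : B.Conn γ) {v : M} (e : γ.star v) (p : B.Fiber v) :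
    MDifferentiable 𝓘(ℝ, EG) (model EG γ) fun g => A.twist e.1 (FiberIso.loop p g) :=
  (Conn.contMDiff_twist_loop A e p).mdifferentiable (by simp)

/-- The covector at the identity of `G` defined by a covector at `A`, an edge `e` outgoing at `v`
and a point in the fibre over `v`. -/
def Conn.loopForm (A : B.Conn γ) {v : M} (e : γ.star v) (p : B.Fiber v) :
    Covector A →ₗ[ℝ] GCovector EG (1 : G) :=
  Conn.pullAlong (fun g => A.twist e.1 (FiberIso.loop p g)) (A.twist_loop_one e.1 p)

theorem Conn.loopForm_act (A : B.Conn γ) {v : M} (e : γ.star v) (p : B.Fiber v) (a : G)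
    (α : Covector A) : A.loopForm e (p.act a) α =
      pullG EG (fun x => a * x * a⁻¹) 1 (A.loopForm e p α : EG →L[ℝ] ℝ) :=
  Conn.pullAlong_comp (f := fun x => a * x * a⁻¹) _ (A.mdifferentiable_twist_loop e p) (by simp)
    ((mdifferentiable_mul_right _).comp (mdifferentiable_mul_left _)) _
    (fun g => by rw [FiberIso.loop_act]) α

/-- The scalar product of two loop forms does not depend on the point in the fibre. -/
theorem Conn.form_loopForm (k : InvariantMetric EG G) (A : B.Conn γ) {v : M} (e e' : γ.star v)
    (p q : B.Fiber v) (α β : Covector A) :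
    k.form 1 (A.loopForm e q α) (A.loopForm e' q β) =
      k.form 1 (A.loopForm e p α) (A.loopForm e' p β) := by
  obtain ⟨a, rfl⟩ : ∃ a, q = p.act a := ⟨p.div q, (Fiber.act_div p q).symm⟩
  rw [Conn.loopForm_act, Conn.loopForm_act]
  exact k.form_conj a _ _

theorem Conn.mdifferentiable_inject (b : B.Points) (A : B.Conn γ) {v : M} (e : γ.star v) :
    MDifferentiable 𝓘(ℝ, EG) (model EG γ) (A.inject b e) := by
  have h : A.inject b e = (fun g => A.twist e.1 (FiberIso.loop (b v) g)) ∘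
      fun g => (A.outgoing b e)⁻¹ * g := by
    funext g
    simp only [Function.comp_apply]
    rw [← Conn.inject_outgoing_mul, mul_inv_cancel_left]
  rw [h]
  exact (A.mdifferentiable_twist_loop e (b v)).comp (mdifferentiable_mul_left _)

theorem Conn.mfderiv_comp_mul_left {u : G → B.Conn γ}
    (hu : MDifferentiable 𝓘(ℝ, EG) (model EG γ) u) (h : G) {w : G → B.Conn γ}
    (hw : ∀ g, u (h * g) = w g) (α : (γ.edges → EG) →L[ℝ] ℝ) :
    (α.comp (mfderiv 𝓘(ℝ, EG) (model EG γ) u h : EG →L[ℝ] (γ.edges → EG))).comp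
      (mfderiv 𝓘(ℝ, EG) 𝓘(ℝ, EG) (fun g : G => h * g) 1 : EG →L[ℝ] EG) =
        α.comp (mfderiv 𝓘(ℝ, EG) (model EG γ) w 1 : EG →L[ℝ] (γ.edges → EG)) := by
  obtain rfl : (u ∘ fun g => h * g) = w := funext hw
  have hd := mfderiv_comp_of_eq (hu _) (mdifferentiable_mul_left (EG := EG) h 1) (mul_one _)
  rw [mul_one] at hd
  exact (congrArg (fun D : EG →L[ℝ] (γ.edges → EG) => α.comp D) hd).symm

/-- Left translation by the outgoing coordinate turns `inject` into a family of twists, so of all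
the points `b` only `b v` still matters. -/
theorem Conn.toIdentity_edgeForm (b : B.Points) (A : B.Conn γ) {v : M} (e : γ.star v)
    (α : Covector A) :
    toIdentity EG (A.outgoing b e) (A.edgeForm b e α) = A.loopForm e (b v) α :=
  Conn.mfderiv_comp_mul_left (A.mdifferentiable_inject b e) (A.outgoing b e)
    (A.inject_outgoing_mul b e) α

/-! ### The form at a vertex and its behaviour under maps -/

open Classical in
-- The point `p` is unrelated to `b`. This gives independence of `b`, and lets a map be tested with
-- the image of a reference point under it.
theorem kVertex_apply (k : InvariantMetric EG G) (b : B.Points) (A : B.Conn γ) (v : M)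
    (p : B.Fiber v) (α β : Covector A) :
    kVertex k b A v α β =
      (1 / 2 : ℝ) * ∑ e : γ.star v, k.form 1 (A.loopForm e p α) (A.loopForm e p β) +
      (1 / 2 : ℝ) * ∑ e : γ.star v, ∑ e' : γ.star v,
        if FormAnalyticArc n v e.1.1 e'.1.1 then
          k.form 1 (A.loopForm e p α) (A.loopForm e' p β) else 0 := by
  simp only [← Conn.form_loopForm k A _ _ p (b v)]
  unfold kVertex kEdge kPair InvariantMetric.pair
  simp only [LinearMap.add_apply, LinearMap.smul_apply, LinearMap.sum_apply, smul_eq_mul]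
  congr 2
  · refine Finset.sum_congr rfl fun e _ => ?_
    rw [LinearMap.compl₁₂_apply, ← k.form_toIdentity, Conn.toIdentity_edgeForm,
      Conn.toIdentity_edgeForm]
  · refine Finset.sum_congr rfl fun e _ => Finset.sum_congr rfl fun e' _ => ?_
    split_ifs
    · rw [LinearMap.compl₁₂_apply, LinearMap.compl₁₂_apply, Conn.toIdentity_edgeForm,
        Conn.toIdentity_edgeForm]
    · rfl

theorem naturalCometric_apply (k : InvariantMetric EG G) (b : B.Points) (A : B.Conn γ)
    (α β : Covector A) :
    naturalCometric k b γ A α β = ∑ v ∈ γ.vertices, kVertex k b A v α β := by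
  simp only [naturalCometric, LinearMap.sum_apply]

theorem naturalCometric_points (k : InvariantMetric EG G) (b b' : B.Points) :
    naturalCometric k b = naturalCometric k b' := by
  funext γ A
  refine LinearMap.ext₂ fun α β => ?_
  rw [naturalCometric_apply, naturalCometric_apply]
  refine Finset.sum_congr rfl fun v _ => ?_
  rw [kVertex_apply k b A v (b v), kVertex_apply k b' A v (b v)]

/-- Loop forms of pulled back covectors agree along `ι` by `h` and vanish off its range by `h0`, so
both sums reduce to the edges of `γ` at `v`. -/
theorem kVertex_pullCov (k : InvariantMetric EG G) (b : B.Points) {f : B.Conn γ' → B.Conn γ}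
    (hf : MDifferentiable (model EG γ') (model EG γ) f) (A : B.Conn γ') {v v' : M}
    (p : B.Fiber v) (p' : B.Fiber v') (ι : γ.star v → γ'.star v') (hι : Function.Injective ι)
    (h : ∀ e g, f (A.twist (ι e).1 (FiberIso.loop p' g)) = (f A).twist e.1 (FiberIso.loop p g))
    (h0 : ∀ e, e ∉ range ι → ∀ g, f (A.twist e.1 (FiberIso.loop p' g)) = f A)
    (harc : ∀ e e', FormAnalyticArc n v' (ι e).1.1 (ι e').1.1 ↔ FormAnalyticArc n v e.1.1 e'.1.1)
    (α β : Covector (f A)) :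
    kVertex k b A v' (pullCov f A α) (pullCov f A β) = kVertex k b (f A) v α β := by
  classical
  have key : ∀ e (α : Covector (f A)),
      A.loopForm (ι e) p' (pullCov f A α) = (f A).loopForm e p α := fun e α =>
    Conn.pullAlong_pullCov hf _ (A.mdifferentiable_twist_loop _ _) _ (h e) α
  have key0 : ∀ e, e ∉ range ι → ∀ (α : Covector (f A)),
      A.loopForm e p' (pullCov f A α) = 0 := fun e he α =>
    (Conn.pullAlong_pullCov hf _ (A.mdifferentiable_twist_loop _ _) rfl (h0 e he) α).trans
      (Conn.pullAlong_const α)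
  rw [kVertex_apply k b A v' p', kVertex_apply k b (f A) v p]
  congr 2
  · symm
    refine Fintype.sum_of_injective ι hι _ _ (fun e he => ?_) fun e => ?_
    · rw [key0 e he, map_zero, LinearMap.zero_apply]
    · rw [key, key]
  · symm
    refine Fintype.sum_of_injective ι hι _ _ (fun e he => ?_) fun e => ?_
    · refine Finset.sum_eq_zero fun e' _ => ?_
      rw [key0 e he, map_zero, LinearMap.zero_apply, ite_self]
    · refine Fintype.sum_of_injective ι hι _ _ (fun e' he => ?_) fun e' => ?_
      · rw [key0 e' he, map_zero, ite_self]
      · rw [key, key, if_congr (harc e e') rfl rfl]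

theorem kVertex_pullCov_eq_zero (k : InvariantMetric EG G) (b : B.Points)
    {f : B.Conn γ' → B.Conn γ} (hf : MDifferentiable (model EG γ') (model EG γ) f) (A : B.Conn γ')
    {v : M} (h0 : ∀ (e : γ'.star v) (φ : B.FiberIso v v), f (A.twist e.1 φ) = f A)
    (α β : Covector (f A)) :
    kVertex k b A v (pullCov f A α) (pullCov f A β) = 0 := by
  classical
  have key0 : ∀ e (α : Covector (f A)), A.loopForm e (b v) (pullCov f A α) = 0 := fun e α =>
    (Conn.pullAlong_pullCov hf _ (A.mdifferentiable_twist_loop _ _) rfl (fun _ => h0 e _) α).trans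
      (Conn.pullAlong_const α)
  rw [kVertex_apply k b A v (b v)]
  simp [key0]

/-- Only `e₁` and `e₂` have non-zero loop forms, and by `h` these are opposite. -/
theorem kVertex_pullCov_eq_zero_of_pair (k : InvariantMetric EG G) (b : B.Points)
    {f : B.Conn γ' → B.Conn γ} (hf : MDifferentiable (model EG γ') (model EG γ) f) (A : B.Conn γ')
    {v : M} {e₁ e₂ : γ'.star v} (hne : e₁ ≠ e₂)
    (h : ∀ φ : B.FiberIso v v, f (A.twist e₂.1 φ) = f (A.twist e₁.1 φ.symm))
    (h0 : ∀ (e : γ'.star v), e ≠ e₁ → e ≠ e₂ → ∀ φ : B.FiberIso v v, f (A.twist e.1 φ) = f A)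
    (h12 : FormAnalyticArc n v e₁.1.1 e₂.1.1) (h21 : FormAnalyticArc n v e₂.1.1 e₁.1.1)
    (h11 : ¬FormAnalyticArc n v e₁.1.1 e₁.1.1) (h22 : ¬FormAnalyticArc n v e₂.1.1 e₂.1.1)
    (α β : Covector (f A)) :
    kVertex k b A v (pullCov f A α) (pullCov f A β) = 0 := by
  classical
  set p := b v
  have key0 : ∀ e, e ≠ e₁ → e ≠ e₂ → ∀ (α : Covector (f A)),
      A.loopForm e p (pullCov f A α) = 0 := fun e he₁ he₂ α =>
    (Conn.pullAlong_pullCov hf _ (A.mdifferentiable_twist_loop _ _) rfl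
      (fun _ => h0 e he₁ he₂ _) α).trans (Conn.pullAlong_const α)
  have hfd : MDifferentiable 𝓘(ℝ, EG) (model EG γ)
      fun g => f (A.twist e₁.1 (FiberIso.loop p g)) := hf.comp (A.mdifferentiable_twist_loop _ _)
  have hneg : ∀ α : Covector (f A), A.loopForm e₂ p (pullCov f A α) =
      -A.loopForm e₁ p (pullCov f A α) := fun α => by
    have h1 := Conn.pullAlong_pullCov hf (A.twist_loop_one e₁.1 p)
      (A.mdifferentiable_twist_loop e₁ p)
      (congrArg f (A.twist_loop_one e₁.1 p)) (fun _ => rfl) α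
    have h2 := Conn.pullAlong_pullCov hf (A.twist_loop_one e₂.1 p)
      (A.mdifferentiable_twist_loop e₂ p)
      (congrArg f (A.twist_loop_one e₂.1 p)) (fun _ => rfl) α
    refine h2.trans (.trans ?_ (congrArg Neg.neg h1.symm))
    exact Conn.pullAlong_inv _ hfd _ (fun g => by rw [h, FiberIso.loop_symm]) α
  have hsum : ∀ F : γ'.star v → ℝ, (∀ e, e ≠ e₁ → e ≠ e₂ → F e = 0) →
      ∑ e, F e = F e₁ + F e₂ := fun F hF =>
    Fintype.sum_eq_add e₁ e₂ hne fun e he => hF e he.1 he.2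
  rw [kVertex_apply k b A v p, hsum, hsum, hsum, hsum]
  -- If `a` is the scalar product of the two loop forms along `e₁`, the diagonal sum contributes `(a
  -- + a) / 2` and the arcs contribute `(-a - a) / 2`.
  · rw [if_neg h11, if_neg h22, if_pos h12, if_pos h21, hneg, hneg]
    simp only [map_neg, LinearMap.neg_apply]
    ring
  all_goals intro e h₁ h₂
  · rw [key0 e h₁ h₂, map_zero, ite_self]
  · rw [key0 e h₁ h₂, map_zero, ite_self]
  · refine Finset.sum_eq_zero fun e' _ => ?_
    rw [key0 e h₁ h₂, map_zero, LinearMap.zero_apply, ite_self]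
  · rw [key0 e h₁ h₂, map_zero, LinearMap.zero_apply]

end PrincipalBundle

end Bundle

/-! ### Analytic arcs -/

section Calculus

/-- If a curve with non-zero velocity `u` at its initial point is run through by another curve
which is differentiable at an interior parameter where it meets the initial point, then the
velocity of the latter vanishes there. -/
theorem eq_zero_of_hasDerivAt_of_eventually_eq_comp {E : Type*} [NormedAddCommGroup E]
    [InnerProductSpace ℝ E] {F H : ℝ → E} {u w : E} {s : ℝ → ℝ} (hF : HasDerivAt F u 0)
    (hH : HasDerivAt H w 0) (hu : u ≠ 0) (hs : Filter.Tendsto s (nhds 0) (nhds 0)) (hs0 : s 0 = 0)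
    (hs_nonneg : ∀ᶠ t in nhds 0, 0 ≤ s t) (hsF : ∀ᶠ t in nhds 0, F (s t) = H t) : w = 0 := by
  have hu2 : 0 < ‖u‖ ^ 2 := by positivity
  have hH0 : F 0 = H 0 := by simpa [hs0] using hsF.self_of_nhds
  have hf : HasDerivAt (fun σ => inner ℝ u (F σ)) (‖u‖ ^ 2) 0 := by
    have h := (hasDerivAt_const (0 : ℝ) u).inner ℝ hF
    simpa using h
  have hh : HasDerivAt (fun t => inner ℝ u (H t)) (inner ℝ u w) 0 := by
    have h := (hasDerivAt_const (0 : ℝ) u).inner ℝ hH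
    simpa using h
  -- The component of `F` along `u` grows at rate `‖u‖ ^ 2`; half of this rate is given up to absorb
  -- the error term.
  have hlow : ∀ᶠ t in nhds 0, ‖u‖ ^ 2 / 2 * s t ≤ inner ℝ u (H t) - inner ℝ u (H 0) := by
    have h1 := hs.eventually ((hasDerivAt_iff_isLittleO.1 hf).bound (half_pos hu2))
    filter_upwards [h1, hs_nonneg, hsF] with t ht hst hFt
    rw [hFt, hH0, sub_zero, smul_eq_mul, Real.norm_eq_abs, Real.norm_eq_abs,
      abs_of_nonneg hst] at ht
    linarith [(abs_le.1 ht).1]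
  -- As `s` is non-negative on both sides of `0`, the component of `H` along `u` has a minimum there
  -- and its derivative vanishes. Read backwards, `hlow` then gives `s t = o(t)`, hence `H t - H 0 =
  -- F (s t) - F 0 = o(t)`.
  have hmin : IsLocalMin (fun t => inner ℝ u (H t)) 0 := by
    filter_upwards [hlow, hs_nonneg] with t ht hst
    have : 0 ≤ ‖u‖ ^ 2 / 2 * s t := by positivity
    linarith
  have huw := hmin.hasDerivAt_eq_zero hh
  rw [huw, hasDerivAt_iff_isLittleO] at hh
  have hslo : s =o[nhds 0] fun t => t - 0 := by
    refine Asymptotics.IsBigO.trans_isLittleO (g := fun t => inner ℝ u (H t) - inner ℝ u (H 0)) ?_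
      (by simpa using hh)
    refine Asymptotics.IsBigO.of_bound (2 / ‖u‖ ^ 2) ?_
    filter_upwards [hlow, hs_nonneg] with t ht hst
    rw [Real.norm_eq_abs, abs_of_nonneg hst]
    calc s t = 2 / ‖u‖ ^ 2 * (‖u‖ ^ 2 / 2 * s t) := by field_simp
      _ ≤ _ := by gcongr; exact ht.trans (le_abs_self _)
  have hHlo : (fun t => H t - H 0) =o[nhds 0] fun t => t - 0 := by
    refine Asymptotics.IsBigO.trans_isLittleO (g := s) ?_ hslo
    refine (hF.isBigO_sub.comp_tendsto hs).congr' ?_ ?_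
    · filter_upwards [hsF] with t ht
      simp [ht, hH0]
    · exact Filter.Eventually.of_forall fun t => by simp
  exact hH.unique (hasDerivAt_iff_isLittleO.2 (by simpa using hHlo))

end Calculus

section Arcs

variable {n : ℕ} {M : Type*} [TopologicalSpace M] [ChartedSpace (EuclideanSpace ℝ (Fin n)) M]

/-- The velocity of a curve in a chart. -/
theorem hasDerivAt_extChartAt_comp {c : ℝ → M} {t : ℝ}
    (hc : MDifferentiableAt 𝓘(ℝ, ℝ) (𝓡 n) c t) :
    HasDerivAt (fun s => extChartAt (𝓡 n) (c t) (c s))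
      ((mfderiv 𝓘(ℝ, ℝ) (𝓡 n) c t : ℝ →L[ℝ] EuclideanSpace ℝ (Fin n)) 1) t := by
  have key : ∀ (F : ℝ → EuclideanSpace ℝ (Fin n)) (D : ℝ →L[ℝ] EuclideanSpace ℝ (Fin n)),
      HasFDerivWithinAt F D (range 𝓘(ℝ, ℝ)) t → HasDerivAt F (D 1) t := by
    intro F D h
    rw [ModelWithCorners.range_eq_univ, hasFDerivWithinAt_univ] at h
    exact h.hasDerivAt
  exact key _ _ hc.hasMFDerivAt.2

theorem velocity_ne_zero {c : ℝ → M} {t : ℝ} (h : mfderiv 𝓘(ℝ, ℝ) (𝓡 n) c t ≠ 0) :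
    (mfderiv 𝓘(ℝ, ℝ) (𝓡 n) c t : ℝ →L[ℝ] EuclideanSpace ℝ (Fin n)) 1 ≠ 0 := by
  intro h0
  have hD : (mfderiv 𝓘(ℝ, ℝ) (𝓡 n) c t : ℝ →L[ℝ] EuclideanSpace ℝ (Fin n)) = 0 :=
    ContinuousLinearMap.ext_ring h0
  exact h hD

theorem contMDiffAt_comp_affine {c : ℝ → M} {a b t s : ℝ} (hs : a * t + b = s)
    (hc : ContMDiffAt 𝓘(ℝ, ℝ) (𝓡 n) ω c s) :
    ContMDiffAt 𝓘(ℝ, ℝ) (𝓡 n) ω (fun s => c (a * s + b)) t := by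
  subst hs
  exact hc.comp t (f := fun s : ℝ => a * s + b)
    ((contDiff_const.mul contDiff_id).add contDiff_const).contMDiff.contMDiffAt

theorem mfderiv_comp_affine_ne_zero {c : ℝ → M} {a b t s : ℝ} (hs : a * t + b = s) (ha : a ≠ 0)
    (hc : ContMDiffAt 𝓘(ℝ, ℝ) (𝓡 n) ω c s) (h : mfderiv 𝓘(ℝ, ℝ) (𝓡 n) c s ≠ 0) :
    mfderiv 𝓘(ℝ, ℝ) (𝓡 n) (fun s => c (a * s + b)) t ≠ 0 := by
  subst hs
  have hd : HasFDerivAt (fun s : ℝ => a * s + b) (ContinuousLinearMap.toSpanSingleton ℝ a) t := by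
    have := ((hasDerivAt_id t).const_mul a).add_const b
    simpa using this.hasFDerivAt
  have hcomp :=
    mfderiv_comp t (hc.mdifferentiableAt (by simp)) hd.differentiableAt.mdifferentiableAt
  rw [mfderiv_eq_fderiv, hd.fderiv] at hcomp
  intro h0
  have h0' : mfderiv 𝓘(ℝ, ℝ) (𝓡 n) (c ∘ fun s => a * s + b) t = 0 := h0
  rw [h0'] at hcomp
  have key : ∀ D : ℝ →L[ℝ] EuclideanSpace ℝ (Fin n),
      0 = D.comp (ContinuousLinearMap.toSpanSingleton ℝ a) → D 1 = 0 := by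
    intro D hD
    have h1 := DFunLike.congr_fun hD (1 : ℝ)
    have h2 : ContinuousLinearMap.toSpanSingleton ℝ a (1 : ℝ) = a • (1 : ℝ) := by simp
    rw [ContinuousLinearMap.comp_apply, h2, map_smul] at h1
    exact (smul_eq_zero.1 h1.symm).resolve_left ha
  exact velocity_ne_zero h (key _ hcomp)

theorem FormAnalyticArc.symm {v : M} {e e' : Set M} (h : FormAnalyticArc n v e e') :
    FormAnalyticArc n v e' e := by
  obtain ⟨c, h0, hc, hd, ε, hε, he, he'⟩ := h
  refine ⟨fun t => c (-1 * t + 0), by simpa using h0, contMDiffAt_comp_affine (by simp) hc,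
    mfderiv_comp_affine_ne_zero (by simp) (by norm_num) hc hd, ε, hε,
    fun t ht => he' _ ?_, fun t ht => he _ ?_⟩
  · constructor <;> linarith [ht.1, ht.2]
  · constructor <;> linarith [ht.1, ht.2]

theorem formAnalyticArc_comm {v : M} {e e' : Set M} :
    FormAnalyticArc n v e e' ↔ FormAnalyticArc n v e' e := ⟨.symm, .symm⟩

theorem FormAnalyticArc.image {v : M} {e e' : Set M} (h : FormAnalyticArc n v e e')
    (Φ : AnalyticDiffeo n M) : FormAnalyticArc n (Φ v) (Φ '' e) (Φ '' e') := by
  obtain ⟨c, h0, hc, hd, ε, hε, he, he'⟩ := h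
  refine ⟨fun t => Φ (c t), congrArg Φ h0, (Φ.contMDiff (c 0)).comp 0 hc, fun hd0 => hd ?_, ε, hε,
    fun t ht => mem_image_of_mem _ (he t ht), fun t ht => mem_image_of_mem _ (he' t ht)⟩
  have hcd : MDifferentiableAt 𝓘(ℝ, ℝ) (𝓡 n) (fun t => Φ (c t)) 0 :=
    ((Φ.contMDiff (c 0)).comp 0 hc).mdifferentiableAt (by simp)
  have hs : MDifferentiableAt (𝓡 n) (𝓡 n) Φ.symm (Φ (c 0)) :=
    (Φ.symm.contMDiff (Φ (c 0))).mdifferentiableAt (by simp)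
  have hcomp := mfderiv_comp 0 hs hcd
  have hfun : (Φ.symm ∘ fun t => Φ (c t)) = c := by
    funext s; simp
  rw [hd0, hfun] at hcomp
  rw [hcomp]
  exact ContinuousLinearMap.comp_zero _

theorem formAnalyticArc_image {v : M} {e e' : Set M} (Φ : AnalyticDiffeo n M) :
    FormAnalyticArc n v (Φ '' e) (Φ '' e') ↔ FormAnalyticArc n (Φ.symm v) e e' := by
  constructor
  · intro h
    have := h.image Φ.symm
    rwa [image_image, image_image, image_congr fun a _ => Φ.symm_apply_apply a,
      image_congr fun a _ => Φ.symm_apply_apply a, image_id', image_id'] at this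
  · intro h
    have := h.image Φ
    rwa [Φ.apply_symm_apply] at this

/-- The parametrization itself, shifted so that `s` becomes `0`, is the required curve. -/
theorem IsParam.formAnalyticArc {c : ℝ → M} (hc : IsParam n c) {a s b : ℝ} (ha : 0 ≤ a)
    (has : a < s) (hsb : s < b) (hb : b ≤ 1) :
    FormAnalyticArc n (c s) (c '' Icc a s) (c '' Icc s b) := by
  have hs : s ∈ Icc (0 : ℝ) 1 := ⟨by linarith, by linarith⟩
  refine ⟨fun t => c (1 * t + s), by simp, contMDiffAt_comp_affine (by simp) (hc.1 s hs),
    mfderiv_comp_affine_ne_zero (by simp) one_ne_zero (hc.1 s hs) (hc.2.1 s hs),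
    min (s - a) (b - s),
    lt_min (by linarith) (by linarith), fun t ht => ⟨_, ?_, rfl⟩, fun t ht => ⟨_, ?_, rfl⟩⟩
  · have := min_le_left (s - a) (b - s)
    constructor <;> linarith [ht.1, ht.2]
  · have := min_le_right (s - a) (b - s)
    constructor <;> linarith [ht.1, ht.2]

/-- Whether two edges form an analytic arc depends only on the edges near the vertex. -/
theorem FormAnalyticArc.of_subset_union {v : M} {e e' e₁ e₁' K K' : Set M}
    (h : FormAnalyticArc n v e e') (hK : IsClosed K) (hK' : IsClosed K') (hv : v ∉ K)
    (hv' : v ∉ K') (he : e ⊆ e₁ ∪ K) (he' : e' ⊆ e₁' ∪ K') : FormAnalyticArc n v e₁ e₁' := by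
  obtain ⟨c, rfl, hc, hd, ε, hε, hce, hce'⟩ := h
  have hev : ∀ᶠ t in nhds 0, c t ∈ Kᶜ ∩ K'ᶜ :=
    hc.continuousAt.eventually ((hK.isOpen_compl.inter hK'.isOpen_compl).mem_nhds ⟨hv, hv'⟩)
  obtain ⟨δ, hδ, hball⟩ := Metric.eventually_nhds_iff.1 hev
  refine ⟨c, rfl, hc, hd, min ε δ, lt_min hε hδ, fun t ht => ?_, fun t ht => ?_⟩
  · have h1 := min_le_left ε δ
    have h2 := min_le_right ε δ
    have hδt : dist t 0 < δ := by
      rw [Real.dist_eq, sub_zero, abs_lt]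
      constructor <;> linarith [ht.1, ht.2]
    exact (he (hce t ⟨by linarith [ht.1], ht.2⟩)).resolve_right (hball hδt).1
  · have h1 := min_le_left ε δ
    have h2 := min_le_right ε δ
    have hδt : dist t 0 < δ := by
      rw [Real.dist_eq, sub_zero, abs_lt]
      constructor <;> linarith [ht.1, ht.2]
    exact (he' (hce' t ⟨ht.1, by linarith [ht.2]⟩)).resolve_right (hball hδt).2

theorem FormAnalyticArc.mono {v : M} {e e' e₁ e₁' : Set M} (h : FormAnalyticArc n v e e')
    (he : e ⊆ e₁) (he' : e' ⊆ e₁') : FormAnalyticArc n v e₁ e₁' := by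
  obtain ⟨c, h0, hc, hd, ε, hε, hce, hce'⟩ := h
  exact ⟨c, h0, hc, hd, ε, hε, fun t ht => he (hce t ht), fun t ht => he' (hce' t ht)⟩

theorem IsParam.continuousOn {c : ℝ → M} (hc : IsParam n c) : ContinuousOn c (Icc 0 1) :=
  fun t ht => (hc.1 t ht).continuousAt.continuousWithinAt

theorem IsParam.isClosed_image [T2Space M] {c : ℝ → M} (hc : IsParam n c) {a b : ℝ} (ha : 0 ≤ a)
    (hb : b ≤ 1) : IsClosed (c '' Icc a b) :=
  (isCompact_Icc.image_of_continuousOn (hc.continuousOn.mono (Icc_subset_Icc ha hb))).isClosed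

theorem IsParam.mem_image_iff {c : ℝ → M} (hc : IsParam n c) {a b s : ℝ} (ha : 0 ≤ a)
    (hb : b ≤ 1) (hs : s ∈ Icc (0 : ℝ) 1) : c s ∈ c '' Icc a b ↔ s ∈ Icc a b :=
  hc.2.2.mem_image_iff (Icc_subset_Icc ha hb) hs

/-- An edge does not form an analytic arc with itself. -/
theorem not_formAnalyticArc_self [T2Space M] {v : M} {e : Set M} (hv : v ∈ ends n e) :
    ¬FormAnalyticArc n v e e := by
  rintro ⟨c, hcv, hc, hcd, ε, hε, hl, hr⟩
  obtain ⟨w, d, hd, hd0, -, rfl⟩ := hv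
  -- Near `0` the curve `c` stays in `e` on both sides and factors through the parametrization `d`
  -- starting at `v`. The bound on `t` stands inside the existential so that `choose` yields a
  -- function on all of `ℝ`; its values elsewhere are arbitrary.
  have hmem : ∀ t : ℝ, ∃ s, |t| < ε → s ∈ Icc (0 : ℝ) 1 ∧ d s = c t := by
    intro t
    by_cases ht : |t| < ε
    · have hct : c t ∈ d '' Icc 0 1 := by
        rcases le_total t 0 with h | h
        · exact hl t ⟨(abs_lt.1 ht).1, h⟩
        · exact hr t ⟨h, (abs_lt.1 ht).2⟩
      obtain ⟨s, hs, hst⟩ := hct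
      exact ⟨s, fun _ => ⟨hs, hst⟩⟩
    · exact ⟨0, fun h => absurd h ht⟩
  choose s hs using hmem
  have hev : ∀ᶠ t in nhds (0 : ℝ), |t| < ε := by
    filter_upwards [Metric.ball_mem_nhds (0 : ℝ) hε] with t ht
    simpa [Real.dist_eq] using ht
  have h01 : (0 : ℝ) ∈ Icc (0 : ℝ) 1 := by simp
  have hs0 : s 0 = 0 := by
    have h := hs 0 (by simpa using hε)
    exact hd.2.2 h.1 h01 (by rw [h.2, hcv, hd0])
  -- Continuity of `s` at `0` comes from compactness: `d '' Icc δ 1` is closed and misses `v`, so `c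
  -- t` avoids it for small `t`.
  have hlim : Filter.Tendsto s (nhds 0) (nhds 0) := by
    rw [Metric.tendsto_nhds]
    intro δ hδ
    have hK : IsClosed (d '' Icc δ 1) := hd.isClosed_image hδ.le le_rfl
    have hvK : c 0 ∉ d '' Icc δ 1 := by
      rw [hcv, ← hd0, hd.mem_image_iff hδ.le le_rfl h01]
      exact fun h => absurd h.1 (not_le.2 hδ)
    filter_upwards [hev, hc.continuousAt.eventually (hK.isOpen_compl.mem_nhds hvK)] with t ht htK
    obtain ⟨h1, h2⟩ := hs t ht
    rw [Real.dist_eq, sub_zero, abs_of_nonneg h1.1]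
    by_contra hle
    exact htK ⟨s t, ⟨not_lt.1 hle, h1.2⟩, h2⟩
  have hF := hasDerivAt_extChartAt_comp (n := n) ((hd.1 0 h01).mdifferentiableAt (by simp))
  have hH := hasDerivAt_extChartAt_comp (n := n) (hc.mdifferentiableAt (by simp))
  rw [hd0] at hF
  rw [hcv] at hH
  refine velocity_ne_zero hcd (eq_zero_of_hasDerivAt_of_eventually_eq_comp hF hH
    (velocity_ne_zero (hd.2.1 0 h01)) hlim hs0 ?_ ?_)
  · filter_upwards [hev] with t ht using (hs t ht).1.1
  · filter_upwards [hev] with t ht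
    rw [(hs t ht).2]

end Arcs

/-! ### Parallel transports along strings of edges -/

section Bundle

variable {n : ℕ} {M : Type*} [TopologicalSpace M] [ChartedSpace (EuclideanSpace ℝ (Fin n)) M]
  {EG : Type*} [NormedAddCommGroup EG] [NormedSpace ℝ EG]
  {G : Type*} [TopologicalSpace G] [ChartedSpace EG G] [Group G]
  {EP : Type*} [NormedAddCommGroup EP] [NormedSpace ℝ EP]
  {P : Type*} [TopologicalSpace P] [ChartedSpace EP P]

namespace GraphPath

variable {γ : Graph n M} {c : ℝ → M} {a b : ℝ}

theorem IsTraversedBy.basic {x y : M} {p : GraphPath γ x y} (h : p.IsTraversedBy c a b) :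
    a < b ∧ c a = x ∧ c b = y := by
  induction p generalizing a with
  | single e he => exact ⟨h.1, h.2.1, h.2.2.1⟩
  | cons e he p ih =>
    obtain ⟨t, hat, htb, hca, -, -, hp⟩ := h
    exact ⟨hat.trans htb, hca, (ih hp).2.2⟩

variable (B : PrincipalBundle n M EG G EP P) [T2Space M]

open PrincipalBundle

/-- A twist at `v` changes only transports along edges ending at `v`, and every vertex met by the
string lies on the traversed curve. -/
theorem IsTraversedBy.alongPath_twist_of_notMem {B : PrincipalBundle n M EG G EP P} {x y v : M}
    {p : GraphPath γ x y} (h : p.IsTraversedBy c a b) (hv : v ∉ c '' Icc a b) (e : γ.edges)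
    (A : B.Conn γ) (φ : B.FiberIso v v) : (A.twist e φ).alongPath p = A.alongPath p := by
  induction p generalizing a with
  | single e' he =>
    obtain ⟨hab, ha, hb, -⟩ := h
    refine A.twist_map_of_ne e e' φ he ?_ ?_
    · rintro rfl
      exact hv ⟨a, left_mem_Icc.2 hab.le, ha⟩
    · rintro rfl
      exact hv ⟨b, right_mem_Icc.2 hab.le, hb⟩
  | cons e' he p ih =>
    obtain ⟨t, hat, htb, ha, ht, -, hp⟩ := h
    simp only [Conn.alongPath]
    rw [ih hp fun hm => hv (image_mono (Icc_subset_Icc_left hat.le) hm),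
      A.twist_map_of_ne e e' φ he ?_ ?_]
    · rintro rfl
      exact hv ⟨a, ⟨le_rfl, (hat.trans htb).le⟩, ha⟩
    · rintro rfl
      exact hv ⟨t, ⟨hat.le, htb.le⟩, ht⟩

/-- The first edge of a string of edges. -/
theorem IsTraversedBy.exists_first {x y : M} {p : GraphPath γ x y} (h : p.IsTraversedBy c a b)
    (hc : InjOn c (Icc a b)) :
    ∃ (e₁ : γ.edges) (t : ℝ), a < t ∧ t ≤ b ∧ x ∈ ends n e₁.1 ∧ e₁.1 = c '' Icc a t ∧
      (∀ (A : B.Conn γ) φ, (A.twist e₁ φ).alongPath p = φ.trans (A.alongPath p)) ∧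
      ∀ (A : B.Conn γ) (φ : B.FiberIso x x) e, e ≠ e₁ →
        (A.twist e φ).alongPath p = A.alongPath p := by
  cases p with
  | single e he =>
    obtain ⟨hab, ha, hb, him⟩ := h
    refine ⟨e, b, hab, le_rfl, ⟨_, he⟩, him.symm, fun A φ => A.twist_map_left e φ he,
      fun A φ e' hne => ?_⟩
    simp only [Conn.alongPath]
    rw [A.twist_of_ne φ hne.symm]
  | cons e he p =>
    obtain ⟨t, hat, htb, ha, ht, him, hp⟩ := h
    -- By injectivity the curve never returns to `x`, so the rest of the string does not notice
    -- twists there.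
    have hx : x ∉ c '' Icc t b := by
      rw [← ha, hc.mem_image_iff (Icc_subset_Icc_left hat.le) ⟨le_rfl, (hat.trans htb).le⟩]
      exact fun h => absurd h.1 (not_le.2 hat)
    refine ⟨e, t, hat, htb.le, ⟨_, he⟩, him.symm, fun A φ => ?_, fun A φ e' hne => ?_⟩
    · simp only [Conn.alongPath]
      rw [hp.alongPath_twist_of_notMem hx, A.twist_map_left, FiberIso.trans_assoc]
    · simp only [Conn.alongPath]
      rw [hp.alongPath_twist_of_notMem hx, A.twist_of_ne φ hne.symm]

/-- The last edge of a string of edges. -/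
theorem IsTraversedBy.exists_last {x y : M} {p : GraphPath γ x y} (h : p.IsTraversedBy c a b)
    (hc : InjOn c (Icc a b)) :
    ∃ (e₁ : γ.edges) (t : ℝ), a ≤ t ∧ t < b ∧ y ∈ ends n e₁.1 ∧ e₁.1 = c '' Icc t b ∧
      (∀ (A : B.Conn γ) φ, (A.twist e₁ φ).alongPath p = (A.alongPath p).trans φ.symm) ∧
      ∀ (A : B.Conn γ) (φ : B.FiberIso y y) e, e ≠ e₁ →
        (A.twist e φ).alongPath p = A.alongPath p := by
  induction p generalizing a with
  | single e he =>
    obtain ⟨hab, ha, hb, him⟩ := h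
    refine ⟨e, a, le_rfl, hab, he.mem_ends_right, him.symm, fun A φ => A.twist_map_right e φ he,
      fun A φ e' hne => ?_⟩
    simp only [Conn.alongPath]
    rw [A.twist_of_ne φ hne.symm]
  | @cons x z y e he p ih =>
    obtain ⟨t, hat, htb, ha, ht, him, hp⟩ := h
    obtain ⟨e₁, t', htt', htb', hy, he₁, h1, h2⟩ := ih hp (hc.mono (Icc_subset_Icc_left hat.le))
    have hcb : c b = y := hp.basic.2.2
    have hxy : x ≠ y := by
      rw [← ha, ← hcb]
      intro h
      exact (hat.trans htb).ne (hc ⟨le_rfl, (hat.trans htb).le⟩ ⟨(hat.trans htb).le, le_rfl⟩ h)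
    have hzy : z ≠ y := by
      rw [← ht, ← hcb]
      intro h
      exact htb.ne (hc ⟨hat.le, htb.le⟩ ⟨(hat.trans htb).le, le_rfl⟩ h)
    refine ⟨e₁, t', hat.le.trans htt', htb', hy, he₁, fun A φ => ?_, fun A φ e' hne => ?_⟩
    · simp only [Conn.alongPath]
      rw [h1, A.twist_map_of_ne _ _ _ _ hxy hzy, FiberIso.trans_assoc]
    · simp only [Conn.alongPath]
      rw [h2 A φ e' hne, A.twist_map_of_ne _ _ _ _ hxy hzy]

/-- The two edges of a string of edges at an interior point. -/
theorem IsTraversedBy.exists_pair {x y v : M} {p : GraphPath γ x y} (h : p.IsTraversedBy c a b)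
    (hc : InjOn c (Icc a b)) {s : ℝ} (has : a < s) (hsb : s < b) (hv : c s = v) :
    (∀ (A : B.Conn γ) (φ : B.FiberIso v v) e, (A.twist e φ).alongPath p = A.alongPath p) ∨
    ∃ (e₁ e₂ : γ.edges) (t₁ t₂ : ℝ), e₁ ≠ e₂ ∧ a ≤ t₁ ∧ t₁ < s ∧ s < t₂ ∧ t₂ ≤ b ∧
      v ∈ ends n e₁.1 ∧ v ∈ ends n e₂.1 ∧ e₁.1 = c '' Icc t₁ s ∧ e₂.1 = c '' Icc s t₂ ∧
      (∀ (A : B.Conn γ) (φ : B.FiberIso v v),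
        (A.twist e₂ φ).alongPath p = (A.twist e₁ φ.symm).alongPath p) ∧
      ∀ (A : B.Conn γ) (φ : B.FiberIso v v) e, e ≠ e₁ → e ≠ e₂ →
        (A.twist e φ).alongPath p = A.alongPath p := by
  induction p generalizing a with
  | @single x y e he =>
    obtain ⟨hab, ha, hb, him⟩ := h
    refine Or.inl fun A φ e' => A.twist_map_of_ne e' e φ he ?_ ?_
    · rw [← ha, ← hv]
      exact fun h => has.ne (hc ⟨le_rfl, hab.le⟩ ⟨has.le, hsb.le⟩ h)
    · rw [← hb, ← hv]
      exact fun h => hsb.ne' (hc ⟨hab.le, le_rfl⟩ ⟨has.le, hsb.le⟩ h)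
  | @cons x z y e he p ih =>
    obtain ⟨t, hat, htb, ha, ht, him, hp⟩ := h
    have hxv : x ≠ v := by
      rw [← ha, ← hv]
      exact fun h => has.ne (hc ⟨le_rfl, (hat.trans htb).le⟩ ⟨has.le, hsb.le⟩ h)
    have hcp : InjOn c (Icc t b) := hc.mono (Icc_subset_Icc_left hat.le)
    have hzv : t ≠ s → z ≠ v := by
      intro hne
      rw [← ht, ← hv]
      exact fun h => hne (hc ⟨hat.le, htb.le⟩ ⟨has.le, hsb.le⟩ h)
    -- The point `v` lies inside the first edge, at its end, or further along; only the middle case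
    -- produces the pair.
    rcases lt_trichotomy s t with hst | hst | hst
    · have hvp : v ∉ c '' Icc t b := by
        rw [← hv, hc.mem_image_iff (Icc_subset_Icc_left hat.le) ⟨has.le, hsb.le⟩]
        exact fun h => absurd h.1 (not_le.2 hst)
      refine Or.inl fun A φ e' => ?_
      simp only [Conn.alongPath]
      rw [hp.alongPath_twist_of_notMem hvp, A.twist_map_of_ne _ _ _ _ hxv (hzv hst.ne')]
    · subst hst
      obtain rfl : z = v := ht.symm.trans hv
      obtain ⟨e₂, t₂, hst₂, ht₂b, hv₂, he₂, h1, h2⟩ := hp.exists_first B hcp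
      have hne : e ≠ e₂ := by
        rintro rfl
        have hmem : c a ∈ c '' Icc s t₂ := by
          rw [← he₂, ← him]
          exact ⟨a, ⟨le_rfl, hat.le⟩, rfl⟩
        rw [hc.mem_image_iff (Icc_subset_Icc has.le ht₂b) ⟨le_rfl, (has.trans hsb).le⟩] at hmem
        exact absurd hmem.1 (not_le.2 has)
      refine Or.inr ⟨e, e₂, a, t₂, hne, le_rfl, has, hst₂, ht₂b, he.mem_ends_right, hv₂, him.symm,
        he₂, fun A φ => ?_, fun A φ e' hne₁ hne₂ => ?_⟩
      · simp only [Conn.alongPath]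
        -- Both twists insert `φ` between `e` and the rest of the string: one at the start of `e₂`,
        -- the other, as the inverse of `φ.symm`, at the end of `e`.
        rw [h1, h2 _ _ e hne, A.twist_map_right, A.twist_of_ne φ hne, FiberIso.trans_assoc]
        rfl
      · simp only [Conn.alongPath]
        rw [h2 _ _ e' hne₂, A.twist_of_ne φ hne₁.symm]
    · rcases ih hp hcp hst with h | ⟨e₁, e₂, t₁, t₂, hne, ht₁, ht₁s, hst₂, ht₂, hv₁, hv₂, he₁, he₂,
        h1, h2⟩
      · refine Or.inl fun A φ e' => ?_
        simp only [Conn.alongPath]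
        rw [h, A.twist_map_of_ne _ _ _ _ hxv (hzv hst.ne)]
      · refine Or.inr ⟨e₁, e₂, t₁, t₂, hne, hat.le.trans ht₁, ht₁s, hst₂, ht₂, hv₁, hv₂, he₁, he₂,
          fun A φ => ?_, fun A φ e' hne₁ hne₂ => ?_⟩
        · simp only [Conn.alongPath]
          rw [h1, A.twist_map_of_ne _ _ _ _ hxv (hzv hst.ne),
            A.twist_map_of_ne _ _ _ _ hxv (hzv hst.ne)]
        · simp only [Conn.alongPath]
          rw [h2 A φ e' hne₁ hne₂, A.twist_map_of_ne _ _ _ _ hxv (hzv hst.ne)]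

end GraphPath

end Bundle

section Bundle

variable {n : ℕ} {M : Type*} [TopologicalSpace M] [ChartedSpace (EuclideanSpace ℝ (Fin n)) M]
  {EG : Type*} [NormedAddCommGroup EG] [NormedSpace ℝ EG]
  {G : Type*} [TopologicalSpace G] [ChartedSpace EG G] [Group G] [LieGroup 𝓘(ℝ, EG) ∞ G]
  {EP : Type*} [NormedAddCommGroup EP] [NormedSpace ℝ EP]
  {P : Type*} [TopologicalSpace P] [ChartedSpace EP P] [T2Space M]

/-! ### Vertices and interior points of edges -/

theorem Graph.mem_vertices {γ : Graph n M} {v : M} :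
    v ∈ γ.vertices ↔ ∃ e : γ.edges, v ∈ ends n e.1 := by
  simp [Graph.vertices]

/-- A vertex of a graph which lies on an edge is an end point of it. -/
theorem Graph.mem_ends_of_mem {γ : Graph n M} {v : M} (hv : v ∈ γ.vertices) (e : γ.edges)
    (he : v ∈ e.1) : v ∈ ends n e.1 := by
  obtain ⟨e', he'⟩ := Graph.mem_vertices.1 hv
  by_cases h : e = e'
  · exact h ▸ he'
  · have hmem : v ∈ e'.1 := by
      obtain ⟨w, c, -, h0, -, him⟩ := he'
      rw [← him, ← h0]
      exact ⟨0, by simp, rfl⟩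
    exact (γ.inter e.1 e.2 e'.1 e'.2 (fun h' => h (Subtype.ext h')) ⟨he, hmem⟩).1

theorem IsParam.notMem_ends {c : ℝ → M} (hc : IsParam n c) {s : ℝ} (h0 : 0 < s) (h1 : s < 1) :
    c s ∉ ends n (c '' Icc 0 1) := by
  intro h
  have harc : IsArc n (c '' Icc 0 1) (c 0) (c 1) := ⟨c, hc, rfl, rfl, rfl⟩
  rcases harc.eq_or_eq h with h | h
  · exact h0.ne' (hc.2.2 ⟨h0.le, h1.le⟩ (by simp) h)
  · exact h1.ne (hc.2.2 ⟨h0.le, h1.le⟩ (by simp) h)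

namespace PrincipalBundle

variable {B : PrincipalBundle n M EG G EP P} {γ γ' : Graph n M} (k : InvariantMetric EG G)
  (b : B.Points)

/-! ### Invariance under gauge transformations and automorphisms -/

theorem naturalCometric_carriedBy_gauge (g : B.GaugeGroup) :
    (naturalCometric k b).CarriedBy (Conn.gauge g : B.Conn γ → B.Conn γ) := by
  intro A α β
  rw [naturalCometric_apply, naturalCometric_apply]
  refine Finset.sum_congr rfl fun v _ => ?_
  exact kVertex_pullCov k b ((Conn.contMDiff_gauge g).mdifferentiable (by simp)) A
    ((g v).1 (b v)) (b v) id Function.injective_id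
    (fun e x => by rw [id, Conn.gauge_twist, FiberIso.loop_conj])
    (fun e he => absurd ⟨e, rfl⟩ he) (fun _ _ => Iff.rfl) α β

/-- The edges of `γ` at `Φ⁻¹(v)` which correspond to the edges of `Φ(γ)` at `v`. -/
def _root_.FloatingLattice.Graph.starComap (Φ : AnalyticDiffeo n M) {v : M}
    (e : (γ.map Φ).star v) : γ.star (Φ.symm v) :=
  ⟨⟨Φ ⁻¹' e.1.1, Graph.preimage_mem e.1.2⟩, ⟨_, e.isArc.comap Φ⟩⟩

theorem _root_.FloatingLattice.Graph.image_starComap (Φ : AnalyticDiffeo n M) {v : M}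
    (e : (γ.map Φ).star v) : Φ '' (Graph.starComap Φ e).1.1 = e.1.1 :=
  image_preimage_eq e.1.1 Φ.surjective

theorem _root_.FloatingLattice.Graph.starComap_bijective (Φ : AnalyticDiffeo n M) (v : M) :
    Function.Bijective (Graph.starComap (γ := γ) Φ (v := v)) := by
  constructor
  · intro e e' h
    apply Subtype.ext
    apply Subtype.ext
    rw [← Graph.image_starComap Φ e, ← Graph.image_starComap Φ e', h]
  · intro e
    refine ⟨⟨Graph.mapEdge Φ e.1, (mem_ends_image Φ).2 e.2⟩, ?_⟩
    exact Subtype.ext (Subtype.ext (preimage_image_diffeo Φ e.1.1))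

theorem _root_.FloatingLattice.Graph.mem_vertices_map (Φ : AnalyticDiffeo n M) {v : M} :
    v ∈ (γ.map Φ).vertices ↔ Φ.symm v ∈ γ.vertices := by
  rw [Graph.mem_vertices, Graph.mem_vertices]
  constructor
  · rintro ⟨e, he⟩
    exact ⟨_, (Graph.starComap Φ (γ := γ) ⟨e, he⟩).2⟩
  · rintro ⟨e, he⟩
    exact ⟨Graph.mapEdge Φ e, (mem_ends_image Φ).2 he⟩

/-- The isomorphisms `τ` may vary arbitrarily with the base point, so bundle automorphisms and maps
given by group valued charts are treated together. -/
theorem naturalCometric_carriedBy_transfer (Φ : AnalyticDiffeo n M)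
    (τ : ∀ y : M, B.FiberIso (Φ.symm y) y) :
    (naturalCometric k b).CarriedBy (Conn.transfer Φ τ : B.Conn γ → B.Conn (γ.map Φ)) := by
  intro A α β
  rw [naturalCometric_apply, naturalCometric_apply]
  symm
  refine Finset.sum_nbij' Φ.symm Φ (fun v hv => (Graph.mem_vertices_map Φ).1 hv)
    (fun v hv => (Graph.mem_vertices_map Φ).2 (by rwa [Φ.symm_apply_apply]))
    (fun v _ => Φ.apply_symm_apply v) (fun v _ => Φ.symm_apply_apply v) fun v _ => ?_
  symm
  refine kVertex_pullCov k b ((Conn.contMDiff_transfer Φ τ).mdifferentiable (by simp)) A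
    ((τ v).1 (b (Φ.symm v))) (b (Φ.symm v)) (Graph.starComap Φ)
    (Graph.starComap_bijective Φ v).1 (fun e x => ?_)
    (fun e he => absurd ((Graph.starComap_bijective Φ v).2 e) he) (fun e e' => ?_) α β
  · have h : Graph.mapEdge Φ (Graph.starComap Φ e).1 = e.1 :=
      Subtype.ext (Graph.image_starComap Φ e)
    rw [Conn.transfer_twist, FiberIso.loop_conj, h]
  · rw [← formAnalyticArc_image Φ, Graph.image_starComap, Graph.image_starComap]

/-! ### Consistency -/

section Consistency

variable (h : γ ≤ γ')

theorem Conn.proj_apply_eq_of_alongPath {A A' : B.Conn γ'} {e : γ.edges}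
    (hA : A.alongPath (Graph.subdivision h e) = A'.alongPath (Graph.subdivision h e)) :
    A.proj h e = A'.proj h e := by
  apply EdgeTransport.ext_map (γ.someOrientation.isArc e)
  rw [Conn.proj_map, Conn.proj_map, hA]

theorem Conn.proj_twist_of_notMem {v : M} {e : γ.edges} (hv : v ∉ e.1) (A : B.Conn γ')
    (e' : γ'.edges) (φ : B.FiberIso v v) : (A.twist e' φ).proj h e = A.proj h e := by
  obtain ⟨c, -, him, hp⟩ := Graph.subdivision_composes h e
  apply Conn.proj_apply_eq_of_alongPath
  exact hp.alongPath_twist_of_notMem (by rwa [him]) e' A φ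

/-- The edge of the finer graph by which an edge begins at one of its end points. -/
theorem exists_initial_edge (B : PrincipalBundle n M EG G EP P) {v : M} (e : γ.edges)
    (hv : v ∈ ends n e.1) :
    ∃ e₁ : γ'.star v, e₁.1.1 ⊆ e.1 ∧ (∃ K, IsClosed K ∧ v ∉ K ∧ e.1 ⊆ e₁.1.1 ∪ K) ∧
      (∃ q ∈ e₁.1.1, q ∉ ends n e.1) ∧
      (∀ (A : B.Conn γ') (φ : B.FiberIso v v),
        (A.twist e₁.1 φ).proj h e = (A.proj h).twist e φ e) ∧
      ∀ (A : B.Conn γ') (φ : B.FiberIso v v) e', e' ≠ e₁.1 →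
        (A.twist e' φ).proj h e = A.proj h e := by
  have harc := γ.someOrientation.isArc e
  obtain ⟨c, hc, him, hp⟩ := Graph.subdivision_composes h e
  obtain ⟨-, hc0, hc1⟩ := hp.basic
  -- The string follows the orientation fixed by `someOrientation`, so `v` may be its start or its
  -- end; in the second case the last edge of the string is the one sought.
  rcases harc.eq_or_eq hv with hv | hv
  · subst hv
    obtain ⟨e₁, t, ht0, ht1, hmem, he₁, h1, h2⟩ := hp.exists_first B hc.2.2
    -- The closed set is the remainder of `e`, which misses `v`. The point `c (t / 2)` of `e₁` is
    -- not an end point of `e`, so no other edge of `γ` contains it; this will distinguish the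
    -- initial pieces of different edges.
    refine ⟨⟨e₁, hmem⟩, ?_, ⟨c '' Icc t 1, hc.isClosed_image ht0.le le_rfl, ?_, ?_⟩,
      ⟨c (t / 2), ?_, ?_⟩, fun A φ => ?_, fun A φ e' hne => ?_⟩
    · rw [he₁, ← him]
      exact image_mono (Icc_subset_Icc_right ht1)
    · rw [← hc0, hc.mem_image_iff ht0.le le_rfl (by simp)]
      exact fun h => absurd h.1 (not_le.2 ht0)
    · rw [he₁, ← him, ← image_union, Icc_union_Icc_eq_Icc ht0.le ht1]
    · rw [he₁]
      exact ⟨t / 2, ⟨by linarith, by linarith⟩, rfl⟩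
    · rw [← him]
      exact hc.notMem_ends (by linarith) (by linarith)
    · apply EdgeTransport.ext_map harc
      rw [Conn.proj_map, h1, Conn.twist_map_left, Conn.proj_map]
    · exact Conn.proj_apply_eq_of_alongPath h (h2 A φ e' hne)
  · subst hv
    obtain ⟨e₁, t, ht0, ht1, hmem, he₁, h1, h2⟩ := hp.exists_last B hc.2.2
    refine ⟨⟨e₁, hmem⟩, ?_, ⟨c '' Icc 0 t, hc.isClosed_image le_rfl ht1.le, ?_, ?_⟩,
      ⟨c ((t + 1) / 2), ?_, ?_⟩, fun A φ => ?_, fun A φ e' hne => ?_⟩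
    · rw [he₁, ← him]
      exact image_mono (Icc_subset_Icc_left ht0)
    · rw [← hc1, hc.mem_image_iff le_rfl ht1.le (by simp)]
      exact fun h => absurd h.2 (not_le.2 ht1)
    · rw [he₁, ← him, ← image_union, union_comm, Icc_union_Icc_eq_Icc ht0 ht1.le]
    · rw [he₁]
      exact ⟨(t + 1) / 2, ⟨by linarith, by linarith⟩, rfl⟩
    · rw [← him]
      exact hc.notMem_ends (by linarith) (by linarith)
    · apply EdgeTransport.ext_map harc
      rw [Conn.proj_map, h1, Conn.twist_map_right, Conn.proj_map]
    · exact Conn.proj_apply_eq_of_alongPath h (h2 A φ e' hne)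

/-- Here `ι` sends an edge of `γ` at `v` to its initial piece in `γ'`. Arcs are preserved in one
direction because the pieces are contained in the edges, in the other because the remainders stay
away from `v`. -/
theorem kVertex_proj_of_mem {v : M} (hv : v ∈ γ.vertices) (A : B.Conn γ')
    (α β : Covector (A.proj h)) :
    kVertex k b A v (pullCov (Conn.proj h) A α) (pullCov (Conn.proj h) A β) =
      kVertex k b (A.proj h) v α β := by
  choose ι hsub hK hq h1 h2 using fun e : γ.star v => exists_initial_edge h B e.1 e.2
  have hinj : Function.Injective ι := by
    intro e e' hee
    by_contra hne
    obtain ⟨q, hq₁, hqe⟩ := hq e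
    have hq' : q ∈ e'.1.1 := hsub e' (hee ▸ hq₁)
    exact hqe (γ.inter e.1.1 e.1.2 e'.1.1 e'.1.2 (fun h => hne (Subtype.ext (Subtype.ext h)))
      ⟨hsub e hq₁, hq'⟩).1
  have hother : ∀ (e : γ.edges) (e' : γ'.star v) (φ : B.FiberIso v v),
      (∀ he : v ∈ ends n e.1, e' ≠ ι ⟨e, he⟩) → (A.twist e'.1 φ).proj h e = A.proj h e := by
    intro e e' φ hne
    by_cases he : v ∈ ends n e.1
    · exact h2 ⟨e, he⟩ A φ e'.1 fun h => hne he (Subtype.ext h)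
    · exact Conn.proj_twist_of_notMem h (fun hm => he (Graph.mem_ends_of_mem hv e hm)) A _ φ
  refine kVertex_pullCov k b ((Conn.contMDiff_proj h).mdifferentiable (by simp)) A (b v) (b v) ι
    hinj (fun e x => ?_) (fun e he x => ?_) (fun e e' => ⟨fun ha => ?_, fun ha => ?_⟩) α β
  · funext e₀
    by_cases he₀ : e₀ = e.1
    · subst he₀
      exact h1 e A _
    · rw [Conn.twist_of_ne _ _ he₀]
      refine hother e₀ (ι e) _ fun he hι => he₀ ?_
      exact (congrArg Subtype.val (hinj hι)).symm
  · funext e₀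
    exact hother e₀ e _ fun he₀ hι => he ⟨_, hι.symm⟩
  · exact ha.mono (hsub e) (hsub e')
  · obtain ⟨K, hKc, hvK, hKe⟩ := hK e
    obtain ⟨K', hKc', hvK', hKe'⟩ := hK e'
    exact ha.of_subset_union hKc hKc' hvK hvK' hKe hKe'

/-- Either `v` lies off `γ` and no transport of the projection sees it, or it is interior to exactly
one edge of `γ`, since distinct edges meet only at end points. In the latter case twists at `v` have
no effect or the two adjacent pieces cancel. -/
theorem kVertex_proj_of_notMem {v : M} (hv : v ∉ γ.vertices) (A : B.Conn γ')
    (α β : Covector (A.proj h)) :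
    kVertex k b A v (pullCov (Conn.proj h) A α) (pullCov (Conn.proj h) A β) = 0 := by
  have hf : MDifferentiable (model EG γ') (model EG γ) (Conn.proj h : B.Conn γ' → B.Conn γ) :=
    (Conn.contMDiff_proj h).mdifferentiable (by simp)
  have hends : ∀ e : γ.edges, v ∉ ends n e.1 := fun e he => hv (Graph.mem_vertices.2 ⟨e, he⟩)
  by_cases hmem : ∃ e : γ.edges, v ∈ e.1
  swap
  · push Not at hmem
    exact kVertex_pullCov_eq_zero k b hf A
      (fun e φ => funext fun e₀ => Conn.proj_twist_of_notMem h (hmem e₀) A e.1 φ) α β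
  obtain ⟨e, hve⟩ := hmem
  have hother : ∀ e₀ : γ.edges, e₀ ≠ e → v ∉ e₀.1 := fun e₀ hne hm =>
    hends e (γ.inter e₀.1 e₀.2 e.1 e.2 (fun h => hne (Subtype.ext h)) ⟨hm, hve⟩).2
  have hext : ∀ A A' : B.Conn γ',
      A.alongPath (Graph.subdivision h e) = A'.alongPath (Graph.subdivision h e) →
      (∀ e₀, e₀ ≠ e → A.proj h e₀ = A'.proj h e₀) → A.proj h = A'.proj h := by
    intro A A' hp hne
    funext e₀
    by_cases he₀ : e₀ = e
    · subst he₀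
      exact Conn.proj_apply_eq_of_alongPath h hp
    · exact hne e₀ he₀
  obtain ⟨c, hc, him, hp⟩ := Graph.subdivision_composes h e
  have hvc := hve
  rw [← him] at hvc
  obtain ⟨s, hs, rfl⟩ := hvc
  have harc : IsArc n e.1 (c 0) (c 1) := ⟨c, hc, rfl, rfl, him⟩
  have hs0 : 0 < s := lt_of_le_of_ne hs.1 fun h => hends e (h ▸ harc.mem_ends_left)
  have hs1 : s < 1 := lt_of_le_of_ne hs.2 fun h => hends e (h ▸ harc.mem_ends_right)
  rcases hp.exists_pair B hc.2.2 hs0 hs1 rfl with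
    htriv | ⟨e₁, e₂, t₁, t₂, hne, ht₁, ht₁s, hst₂, ht₂, hv₁, hv₂, he₁, he₂, h1, h2⟩
  · exact kVertex_pullCov_eq_zero k b hf A (fun e' φ => hext _ _ (htriv A φ e'.1)
      fun e₀ he₀ => Conn.proj_twist_of_notMem h (hother e₀ he₀) A e'.1 φ) α β
  · have h12 : FormAnalyticArc n (c s) e₁.1 e₂.1 := by
      rw [he₁, he₂]
      exact hc.formAnalyticArc ht₁ ht₁s hst₂ ht₂
    refine kVertex_pullCov_eq_zero_of_pair k b hf A (e₁ := ⟨e₁, hv₁⟩) (e₂ := ⟨e₂, hv₂⟩)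
      (fun h => hne (congrArg Subtype.val h)) (fun φ => hext _ _ (h1 A φ) fun e₀ he₀ => ?_)
      (fun e' hne₁ hne₂ φ => hext _ _ (h2 A φ e'.1 (fun h => hne₁ (Subtype.ext h))
        fun h => hne₂ (Subtype.ext h)) fun e₀ he₀ => ?_)
      h12 h12.symm (not_formAnalyticArc_self hv₁) (not_formAnalyticArc_self hv₂) α β
    · rw [Conn.proj_twist_of_notMem h (hother e₀ he₀), Conn.proj_twist_of_notMem h (hother e₀ he₀)]
    · exact Conn.proj_twist_of_notMem h (hother e₀ he₀) A e'.1 φ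

theorem naturalCometric_carriedBy_proj :
    (naturalCometric k b).CarriedBy (Conn.proj h : B.Conn γ' → B.Conn γ) := by
  intro A α β
  rw [naturalCometric_apply, naturalCometric_apply,
    ← Finset.sum_subset h.2 fun v _ hv => kVertex_proj_of_notMem k b h hv A α β]
  exact Finset.sum_congr rfl fun v hv => kVertex_proj_of_mem k b h hv A α β

end Consistency

theorem kVertex_symm (A : B.Conn γ) (v : M) (α β : Covector A) :
    kVertex k b A v α β = kVertex k b A v β α := by
  classical
  rw [kVertex_apply k b A v (b v), kVertex_apply k b A v (b v)]
  congr 2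
  · exact Finset.sum_congr rfl fun e _ => k.symm _ _ _
  · rw [Finset.sum_comm]
    refine Finset.sum_congr rfl fun e _ => Finset.sum_congr rfl fun e' _ => ?_
    rw [k.symm, if_congr formAnalyticArc_comm rfl rfl]

theorem naturalCometric_symm (A : B.Conn γ) (α β : Covector A) :
    naturalCometric k b γ A α β = naturalCometric k b γ A β α := by
  rw [naturalCometric_apply, naturalCometric_apply]
  exact Finset.sum_congr rfl fun v _ => kVertex_symm k b A v α β

theorem naturalCometric_isCometric : (naturalCometric k b).IsCometric :=
  ⟨fun _ => naturalCometric_symm k b, fun _ _ => naturalCometric_carriedBy_proj k b⟩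

/-! ### Invariant one-forms and the quotient -/

theorem OneForm.pull_pull {γ'' : Graph n M} {f : B.Conn γ' → B.Conn γ}
    {f' : B.Conn γ'' → B.Conn γ'} (hf : MDifferentiable (model EG γ') (model EG γ) f)
    (hf' : MDifferentiable (model EG γ'') (model EG γ') f') (α : B.OneForm γ) :
    (α.pull f).pull f' = α.pull (f ∘ f') := by
  funext A
  exact (congrArg (fun D : (γ''.edges → EG) →L[ℝ] (γ.edges → EG) =>
    (α (f (f' A)) : (γ.edges → EG) →L[ℝ] ℝ).comp D) (mfderiv_comp A (hf _) (hf' _))).symm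

/-- Pull-backs of invariant one-forms under maps which are compatible with the gauge
transformations are invariant. -/
theorem OneForm.IsInvariant.pull {α : B.OneForm γ} (hα : α.IsInvariant)
    {f : B.Conn γ' → B.Conn γ} (hf : MDifferentiable (model EG γ') (model EG γ) f)
    (hfg : ∀ g : B.GaugeGroup, ∃ g' : B.GaugeGroup, ∀ A, f (A.gauge g) = (f A).gauge g') :
    (α.pull f).IsInvariant := by
  intro g
  obtain ⟨g', hg'⟩ := hfg g
  have hcomp : f ∘ Conn.gauge g = Conn.gauge g' ∘ f := funext hg'
  rw [OneForm.pull_pull hf ((Conn.contMDiff_gauge g).mdifferentiable (by simp)), hcomp,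
    ← OneForm.pull_pull ((Conn.contMDiff_gauge g').mdifferentiable (by simp)) hf, hα g']

/-- By `transfer_eq_gauge` the two maps differ by a gauge transformation of the target, which the
form absorbs. -/
theorem OneForm.IsInvariant.pull_transfer_congr {Φ : AnalyticDiffeo n M}
    {α : B.OneForm (γ.map Φ)} (hα : α.IsInvariant) (τ τ' : ∀ y : M, B.FiberIso (Φ.symm y) y) :
    α.pull (Conn.transfer Φ τ' : B.Conn γ → B.Conn (γ.map Φ)) = α.pull (Conn.transfer Φ τ) := by
  obtain ⟨g, hg⟩ : ∃ g : B.GaugeGroup, (Conn.transfer Φ τ' : B.Conn γ → B.Conn (γ.map Φ)) =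
      Conn.gauge g ∘ Conn.transfer Φ τ := ⟨_, funext (Conn.transfer_eq_gauge Φ τ τ')⟩
  rw [hg, ← OneForm.pull_pull ((Conn.contMDiff_gauge g).mdifferentiable (by simp))
    ((Conn.contMDiff_transfer Φ τ).mdifferentiable (by simp)), hα]

theorem QConn.diffeo_congr (Φ : AnalyticDiffeo n M) (b₁ b₁' b₂ b₂' : B.Points) :
    (QConn.diffeo Φ b₁ b₁' : B.QConn γ → B.QConn (γ.map Φ)) = QConn.diffeo Φ b₂ b₂' := by
  funext q
  induction q using Quot.ind with
  | mk A => exact Quot.sound ⟨_, Conn.transfer_eq_gauge Φ _ _ A⟩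

theorem naturalCometric_definesNaturalCometricOnQuotient :
    (naturalCometric k b).DefinesNaturalCometricOnQuotient := by
  refine ⟨fun Φ _ _ γ => naturalCometric_carriedBy_transfer k b Φ _,
    fun γ α β => Quot.lift (fun A => naturalCometric k b γ A (α.1 A) (β.1 A)) ?_,
    fun _ _ _ _ => rfl, fun γ α β => ?_, fun γ γ' h => ?_, fun Φ γ => ?_⟩
  -- Invariance identifies the value of a form at `A` with the pull-back of its value at `A.gauge
  -- g`, so gauge invariance of the tensors makes the function well defined.
  · rintro A _ ⟨g, rfl⟩
    have h := naturalCometric_carriedBy_gauge k b g A (α.1 (A.gauge g)) (β.1 (A.gauge g))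
    rw [← h]
    congr 1
    · exact congrArg _ (congrFun (α.2 g) A).symm
    · exact (congrFun (β.2 g) A).symm
  · funext q
    induction q using Quot.ind with
    | mk A => exact naturalCometric_symm k b A _ _
  · refine ⟨fun α => ⟨α.1.pull (Conn.proj h), α.2.pull
      ((Conn.contMDiff_proj h).mdifferentiable (by simp)) fun g => ⟨g, Conn.proj_gauge h g⟩⟩,
      fun _ => rfl, fun α β => ?_⟩
    funext q
    induction q using Quot.ind with
    | mk A => exact naturalCometric_carriedBy_proj k b h A _ _
  · refine ⟨fun α => ⟨α.1.pull (Conn.diffeo Φ b b), α.2.pull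
      ((Conn.contMDiff_transfer Φ _).mdifferentiable (by simp))
      fun g => ⟨_, Conn.transfer_gauge Φ _ g⟩⟩, QConn.diffeo Φ b b,
      fun b₁ b₁' α => α.2.pull_transfer_congr _ _, fun b₁ b₁' => QConn.diffeo_congr Φ b b b₁ b₁',
      fun α β => ?_⟩
    funext q
    induction q using Quot.ind with
    | mk A => exact naturalCometric_carriedBy_transfer k b Φ _ A _ _

end PrincipalBundle

end Bundle

end FloatingLattice

end

open FloatingLattice PrincipalBundle in
theorem proposition11
    (n : ℕ) (M : Type*) [TopologicalSpace M] [T2Space M] [SecondCountableTopology M]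
    [ChartedSpace (EuclideanSpace ℝ (Fin n)) M] [IsManifold (𝓡 n) ω M]
    (EG : Type*) [NormedAddCommGroup EG] [NormedSpace ℝ EG] [FiniteDimensional ℝ EG]
    (G : Type*) [TopologicalSpace G] [ChartedSpace EG G] [Group G] [LieGroup 𝓘(ℝ, EG) ∞ G]
    [T2Space G] [CompactSpace G] [ConnectedSpace G]
    (EP : Type*) [NormedAddCommGroup EP] [NormedSpace ℝ EP] [FiniteDimensional ℝ EP]
    (P : Type*) [TopologicalSpace P] [ChartedSpace EP P] [IsManifold 𝓘(ℝ, EP) ∞ P]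
    (B : PrincipalBundle n M EG G EP P) (k : InvariantMetric EG G) :
    (∀ b b' : B.Points, naturalCometric k b = naturalCometric k b') ∧
    ∀ b : B.Points,
      (naturalCometric k b).IsCometric ∧
      (naturalCometric k b).IsNatural ∧
      (naturalCometric k b).IsGaugeInvariant ∧
      (naturalCometric k b).DefinesNaturalCometricOnQuotient :=
  ⟨naturalCometric_points k, fun b => ⟨naturalCometric_isCometric k b,
    fun F _ => naturalCometric_carriedBy_transfer k b F.base F.fiberIso,
    fun g _ => naturalCometric_carriedBy_gauge k b g,
    naturalCometric_definesNaturalCometricOnQuotient k b⟩⟩
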